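/- Let $F$ be a field. Algebras are associative $F$-algebras, not necessarily with unit. An algebra $A$ is called algebraic if every element $a\in A$ satisfies $p(a)=0$ for some nonzero polynomial $p\in F[t]$ without constant term; it is called stable algebraic if all matrix algebras $M_n(A)$, $n\ge 1$, are algebraic. It is called (left) primitive if it has a faithful left module $M$ that is irreducible, i.e. $AM\neq 0$ and $M$ has no submodules other than $0$ and $M$. Let $M_\infty(A)$ denote the algebra of $\mathbb N\times\mathbb N$ matrices over $A$ having only finitely many nonzero entries. Theorem 5.1. Let $A$ be a stable algebraic primitive $F$-algebra with $\dim_F A\le\aleph_0$. Then there exist an algebraic primitive $F$-algebra $B$ that is generated by two elements and an injective homomorphism of $F$-algebras $\varphi: M_\infty(A)\to B$ whose image is a left ideal of $B$. -/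

import Mathlib

universe u v

/-! Algebras over a field `F` are associative and need not have a unit: they are given by
`[NonUnitalRing A] [Module F A] [IsScalarTower F A A] [SMulCommClass F A A]`. -/

/-- The algebra `M_∞(A)` (for `X` countably infinite): `X × X` matrices over `A` with only
finitely many nonzero entries. The entry of `M` in row `i` and column `j` is `M.entries (i, j)`. -/
@[ext]
structure FinitaryMatrix (X A : Type*) [Zero A] where
  entries : X × X →₀ A

namespace FinitaryMatrix

section Ring

variable {X A : Type*} [NonUnitalRing A]

def equivEntries : FinitaryMatrix X A ≃ (X × X →₀ A) where
  toFun := entries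
  invFun := mk
  left_inv _ := rfl
  right_inv _ := rfl

noncomputable instance : AddCommGroup (FinitaryMatrix X A) := equivEntries.addCommGroup

noncomputable instance {F : Type*} [Semiring F] [Module F A] : Module F (FinitaryMatrix X A) :=
  equivEntries.module F

theorem entries_add (M N : FinitaryMatrix X A) : (M + N).entries = M.entries + N.entries := rfl

theorem entries_zero : (0 : FinitaryMatrix X A).entries = 0 := rfl

theorem entries_smul {F : Type*} [Semiring F] [Module F A] (c : F) (M : FinitaryMatrix X A) :
    (c • M).entries = c • M.entries := rfl

open Classical in
/-- The usual matrix product, `(M * N) i j = ∑ k, M i k * N k j`; the sum runs over the finitely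
many columns `k` in which `M` has a nonzero entry. -/
noncomputable instance : Mul (FinitaryMatrix X A) where
  mul M N :=
    ⟨Finsupp.onFinset (M.entries.support.image Prod.fst ×ˢ N.entries.support.image Prod.snd)
      (fun p => ∑ k ∈ M.entries.support.image Prod.snd,
        M.entries (p.1, k) * N.entries (k, p.2))
      (by
        intro p hp
        obtain ⟨k, -, hk⟩ := Finset.exists_ne_zero_of_sum_ne_zero hp
        refine Finset.mem_product.2 ⟨Finset.mem_image.2 ⟨(p.1, k), ?_, rfl⟩,
          Finset.mem_image.2 ⟨(k, p.2), ?_, rfl⟩⟩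
        · exact Finsupp.mem_support_iff.2 (left_ne_zero_of_mul hk)
        · exact Finsupp.mem_support_iff.2 (right_ne_zero_of_mul hk))⟩

open Classical in
theorem entries_mul_of_left (M N : FinitaryMatrix X A) (s : Finset X)
    (hs : M.entries.support.image Prod.snd ⊆ s) (i j : X) :
    (M * N).entries (i, j) = ∑ k ∈ s, M.entries (i, k) * N.entries (k, j) := by
  refine Finset.sum_subset hs ?_
  intro k _ hk
  have : M.entries (i, k) = 0 := by
    by_contra h
    exact hk (Finset.mem_image.2 ⟨(i, k), Finsupp.mem_support_iff.2 h, rfl⟩)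
  rw [this, zero_mul]

/-- The entries of a product are given by the usual formula. -/
theorem entries_mul (M N : FinitaryMatrix X A) (i j : X) :
    (M * N).entries (i, j) = ∑ᶠ k, M.entries (i, k) * N.entries (k, j) := by
  classical
  rw [entries_mul_of_left M N _ subset_rfl, finsum_eq_sum_of_support_subset]
  intro k hk
  exact Finset.mem_coe.2 (Finset.mem_image.2
    ⟨(i, k), Finsupp.mem_support_iff.2 (left_ne_zero_of_mul hk), rfl⟩)

noncomputable instance : NonUnitalRing (FinitaryMatrix X A) where
  left_distrib M N P := by
    classical
    ext ⟨i, j⟩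
    simp only [entries_add, Finsupp.add_apply, entries_mul_of_left M _ _ subset_rfl, mul_add,
      Finset.sum_add_distrib]
  right_distrib M N P := by
    classical
    ext ⟨i, j⟩
    let s := (M.entries.support ∪ N.entries.support ∪ (M + N).entries.support).image Prod.snd
    have h1 : M.entries.support.image Prod.snd ⊆ s := Finset.image_subset_image (by grind)
    have h2 : N.entries.support.image Prod.snd ⊆ s := Finset.image_subset_image (by grind)
    have h3 : (M + N).entries.support.image Prod.snd ⊆ s := Finset.image_subset_image (by grind)
    simp only [entries_add (M * P), Finsupp.add_apply, entries_mul_of_left M P s h1,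
      entries_mul_of_left N P s h2, entries_mul_of_left (M + N) P s h3, entries_add M N, add_mul,
      Finset.sum_add_distrib]
  zero_mul M := by
    classical
    ext ⟨i, j⟩
    simp [entries_mul_of_left _ _ _ subset_rfl, entries_zero]
  mul_zero M := by
    classical
    ext ⟨i, j⟩
    simp [entries_mul_of_left _ _ _ subset_rfl, entries_zero]
  mul_assoc M N P := by
    classical
    ext ⟨i, j⟩
    let s := (M.entries.support ∪ N.entries.support ∪ (M * N).entries.support).image Prod.snd
    have h1 : M.entries.support.image Prod.snd ⊆ s := Finset.image_subset_image (by grind)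
    have h2 : N.entries.support.image Prod.snd ⊆ s := Finset.image_subset_image (by grind)
    have h3 : (M * N).entries.support.image Prod.snd ⊆ s := Finset.image_subset_image (by grind)
    simp only [entries_mul_of_left M _ s h1, entries_mul_of_left N _ s h2,
      entries_mul_of_left (M * N) _ s h3, Finset.sum_mul, Finset.mul_sum, mul_assoc]
    exact Finset.sum_comm

end Ring

end FinitaryMatrix

section Notions

variable (F : Type*) [Field F]

/-- Every element of `A` is a root of a nonzero polynomial over `F`. Evaluation takes place in
the unital algebra `F ⊕ A`, where the constant term of such a polynomial is forced to vanish. -/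
def IsAlgebraicAlgebra (A : Type*) [NonUnitalRing A] [Module F A] [IsScalarTower F A A]
    [SMulCommClass F A A] : Prop :=
  ∀ a : A, IsAlgebraic F (Unitization.inr a : Unitization F A)

/-- All matrix algebras `M_n(A)` are algebraic. -/
def IsStableAlgebraic (A : Type*) [NonUnitalRing A] [Module F A] [IsScalarTower F A A]
    [SMulCommClass F A A] : Prop :=
  ∀ n : ℕ, IsAlgebraicAlgebra F (Matrix (Fin n) (Fin n) A)

variable {F} in
/-- A left module `M` over a possibly non-unital algebra `A`, given as a representation, is
irreducible: `A M ≠ 0` and `M` has no submodules besides `0` and `M`. -/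
structure IsIrreducibleModule {A M : Type*} [NonUnitalRing A] [Module F A] [AddCommGroup M]
    [Module F M] (ρ : A →ₙₐ[F] Module.End F M) : Prop where
  exists_ne_zero : ∃ a m, ρ a m ≠ 0
  eq_bot_or_eq_top : ∀ N : Submodule F M, (∀ a, ∀ m ∈ N, ρ a m ∈ N) → N = ⊥ ∨ N = ⊤

/-- `A` is (left) primitive: it has a faithful irreducible left module. (An irreducible module is
a quotient of `A`, so that it is no restriction to take it in the universe of `A`.) -/
def IsPrimitiveAlgebra (A : Type u) [NonUnitalRing A] [Module F A] : Prop :=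
  ∃ (M : Type u) (_ : AddCommGroup M) (_ : Module F M) (ρ : A →ₙₐ[F] Module.End F M),
    Function.Injective ρ ∧ IsIrreducibleModule ρ

/-- `B` is generated by two elements as an algebra (without using a unit). -/
def IsTwoGenerated (B : Type*) [NonUnitalRing B] [Module F B] [IsScalarTower F B B]
    [SMulCommClass F B B] : Prop :=
  ∃ x y : B, NonUnitalAlgebra.adjoin F {x, y} = ⊤

/-- There is an embedding of algebras `M_∞(A) → B` whose image is a left ideal of `B`. -/
def IsMInftyEmbeddableAsLeftIdeal (A B : Type*) [NonUnitalRing A] [Module F A]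
    [NonUnitalRing B] [Module F B] : Prop :=
  ∃ φ : FinitaryMatrix ℕ A →ₙₐ[F] B, Function.Injective φ ∧
    ∀ (b : B) (M : FinitaryMatrix ℕ A), b * φ M ∈ Set.range φ

end Notions

/-!
The algebra `B` consists of operators on `Z = U ⊗ (Q ⊗ V)`, where `V` is a faithful irreducible
`A`-module, `U = Q = F^(ℕ)`, and it is generated by `x ⊗ 1` and `g = y ⊗ 1 + c`. Here `x` and `y`
generate a nil algebra `N` of operators on `U`, and `c` is an operator with a single row: it maps
`u ⊗ z` to `e_o ⊗ γ(u) z`, where `γ : U → End (Q ⊗ V)` is linear with `γ(e_o) = 1` and `γ ∘ y = 0`.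

* *Algebraicity.* All operators in `B` are congruent to elements of `N ⊗ 1` modulo operators
  with finitely many rows. The entries of `γ` are taken in `F + K`, where `K` consists of operators
  on `Q ⊗ V` with finitely many rows and entries in `F + A`. The algebra of operators with
  finitely many rows over a stably algebraic algebra is stably algebraic
  (`StablyAlgebraic.rankIdeal`): such an operator factors through a finite power of the second
  tensor factor, and `f ∘ g` and `g ∘ f` are algebraic simultaneously. Algebraicity then lifts to
  `B`, because polynomials annihilating elements of `N` map elements of `B` into an ideal of
  algebraic elements (`isAlgebraic_of_mem_wreathProduct`).
* *Matrix units.* If `y e_o = 0` then `y ⊗ 1` and the idempotent `c` annihilate each other, so that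
  `g ^ k = c` for large `k` (`rowOp_mem_adjoin`). Hence `c` and `y ⊗ 1` belong to `B`. If every
  coordinate functional of `U` is a linear combination of functionals `e_i^* ∘ n` with `n ∈ N`,
  `e_i^* ∘ y = 0` and `i` as large as desired, then `γ` can be chosen so that `B` contains all
  matrix units of `U ⊗ Q` with coefficients in `A` (`blockUnit_mem`). They span `M_∞(A)`, which is
  then a left ideal, and they make `Z` an irreducible module.
* *The nil module.* The operators `x` and `y` come from the construction of Golod and Shafarevich: a
  graded ideal `I` of the free algebra with infinite-dimensional nil quotient. A maximal graded
  ideal `P ⊇ I` of infinite codimension is prime in a strong sense (`exists_mul_mul_notMem`). Let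
  `y ^ k` be the last power of `y` outside `P`. The left ideal `J = {f | f y ^ k ∈ P}` defines a graded
  cyclic nil module `U` in which `y` kills the generator, and primeness shows that homogeneous
  elements have nonzero multiples of arbitrarily large degree outside `y U`. With a basis of words
  part of which spans `y U`, this yields the property of the coordinate functionals
  (`isNilModule_of_representation`).
-/

open scoped TensorProduct

/-! ### Algebraic operators and wreath products -/

section Algebraicity

open Polynomial

/-- Algebraicity lifts along ideal extensions: `s` is congruent to the algebraic element `n` modulo
the subspace `K`, which consists of algebraic elements and behaves like an ideal with respect to `s`
and `n`. If `p` annihilates `n` then `p(s)` lies in `K`. -/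
theorem IsAlgebraic.of_sub_mem {F C : Type*} [Field F] [Ring C] [Algebra F C]
    (K : Submodule F C) {s n : C} (hn : IsAlgebraic F n) (hsub : s - n ∈ K)
    (hl : ∀ k ∈ K, s * k ∈ K) (hr : ∀ k ∈ K, k * n ∈ K) (hK : ∀ k ∈ K, IsAlgebraic F k) :
    IsAlgebraic F s := by
  have key : ∀ p : F[X], aeval s p - aeval n p ∈ K := by
    intro p
    induction p using Polynomial.induction_on' with
    | add p q hp hq =>
      rw [map_add, map_add, add_sub_add_comm]
      exact K.add_mem hp hq
    | monomial k c =>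
      rw [aeval_monomial, aeval_monomial, ← Algebra.smul_def, ← Algebra.smul_def, ← smul_sub]
      refine K.smul_mem _ ?_
      induction k with
      | zero => simp
      | succ k ih =>
        have : s ^ (k + 1) - n ^ (k + 1) = s * (s ^ k - n ^ k) + (s - n) * n ^ k := by
          rw [pow_succ', pow_succ']; noncomm_ring
        rw [this]
        refine K.add_mem (hl _ ih) ?_
        clear ih this
        induction k with
        | zero => simpa using hsub
        | succ k ih => rw [pow_succ, ← mul_assoc]; exact hr _ ih
  obtain ⟨p, hp0, hp⟩ := hn
  have h1 : aeval s (X * p) ∈ K := by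
    have := hl _ (key p)
    rw [hp, sub_zero] at this
    simpa using this
  refine IsAlgebraic.of_aeval (X * p) ?_ ?_ (hK _ h1)
  · rw [natDegree_X_mul hp0]; omega
  · exact mem_nonZeroDivisors_of_ne_zero (leadingCoeff_ne_zero.2 (mul_ne_zero X_ne_zero hp0))

/-- For `f : V → W` and `g : W → V`, algebraicity of `f ∘ g` passes to `g ∘ f`. -/
theorem IsAlgebraic.comp_swap {F V W : Type*} [Field F] [AddCommGroup V] [Module F V]
    [AddCommGroup W] [Module F W] {f : V →ₗ[F] W} {g : W →ₗ[F] V}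
    (h : IsAlgebraic F (f ∘ₗ g : Module.End F W)) : IsAlgebraic F (g ∘ₗ f : Module.End F V) := by
  obtain ⟨p, hp0, hp⟩ := h
  refine ⟨X * p, mul_ne_zero X_ne_zero hp0, ?_⟩
  have key : ∀ q : F[X], aeval (g ∘ₗ f : Module.End F V) (X * q) =
      g ∘ₗ (aeval (f ∘ₗ g : Module.End F W) q) ∘ₗ f := by
    intro q
    induction q using Polynomial.induction_on' with
    | add p q hp hq => rw [mul_add, map_add, map_add, hp, hq]; ext; simp
    | monomial k c =>
      rw [map_mul, aeval_X, aeval_monomial, aeval_monomial, ← Algebra.smul_def,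
        ← Algebra.smul_def, mul_smul_comm, LinearMap.smul_comp, LinearMap.comp_smul]
      congr 1
      induction k with
      | zero => rfl
      | succ k ih =>
        rw [pow_succ, ← mul_assoc, ih, pow_succ]; rfl
  rw [key, hp]; simp

end Algebraicity

section StablyAlgebraic

variable {F : Type*} [Field F] {V : Type*} [AddCommGroup V] [Module F V]

/-- All square matrices with entries in the algebra `S` of operators on `V` are algebraic. -/
def StablyAlgebraic (S : NonUnitalSubalgebra F (Module.End F V)) : Prop :=
  ∀ (n : ℕ) (M : Matrix (Fin n) (Fin n) (Module.End F V)), (∀ i j, M i j ∈ S) → IsAlgebraic F M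

theorem StablyAlgebraic.isAlgebraic_matrix {S : NonUnitalSubalgebra F (Module.End F V)}
    (hS : StablyAlgebraic S) {ι : Type*} [Fintype ι] [DecidableEq ι]
    (M : Matrix ι ι (Module.End F V)) (hM : ∀ i j, M i j ∈ S) : IsAlgebraic F M := by
  have e := Fintype.equivFin ι
  have h := hS _ (Matrix.reindexAlgEquiv F (Module.End F V) e M) (fun i j => by
    simpa using hM _ _)
  have h2 := h.algHom (Matrix.reindexAlgEquiv F (Module.End F V) e).symm.toAlgHom
  simpa using h2

theorem StablyAlgebraic.isAlgebraic {S : NonUnitalSubalgebra F (Module.End F V)}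
    (hS : StablyAlgebraic S) {s : Module.End F V} (hs : s ∈ S) : IsAlgebraic F s := by
  obtain ⟨p, hp0, hp⟩ := hS 1 (Matrix.scalar _ s) (fun i j => by
    rw [Subsingleton.elim i j]; simpa using hs)
  refine ⟨p, hp0, ?_⟩
  have h : Matrix.scalar (Fin 1) s = (Matrix.scalarAlgHom (Fin 1) F) s := rfl
  rw [h, Polynomial.aeval_algHom_apply] at hp
  simpa using congrFun (congrFun hp 0) 0

/-- The algebra `F + S` obtained by adjoining the identity operator to `S`. -/
def scalarExtension (S : NonUnitalSubalgebra F (Module.End F V)) :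
    NonUnitalSubalgebra F (Module.End F V) where
  carrier := {T | ∃ c : F, T - c • 1 ∈ S}
  add_mem' := by
    rintro a b ⟨c, hc⟩ ⟨d, hd⟩
    refine ⟨c + d, ?_⟩
    rw [add_smul, add_sub_add_comm]; exact S.add_mem hc hd
  zero_mem' := ⟨0, by simp⟩
  mul_mem' := by
    rintro a b ⟨c, hc⟩ ⟨d, hd⟩
    refine ⟨c * d, ?_⟩
    have : a * b - (c * d) • (1 : Module.End F V) =
        (a - c • 1) * (b - d • 1) + d • (a - c • 1) + c • (b - d • 1) := by
      simp only [sub_mul, mul_sub, smul_sub, smul_mul_assoc, mul_smul_comm, one_mul, mul_one,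
        smul_smul, mul_comm d c]
      abel
    rw [this]
    exact S.add_mem (S.add_mem (S.mul_mem hc hd) (S.smul_mem d hc)) (S.smul_mem c hd)
  smul_mem' := by
    rintro e a ⟨c, hc⟩
    refine ⟨e * c, ?_⟩
    rw [mul_smul, ← smul_sub]; exact S.smul_mem e hc

theorem le_scalarExtension (S : NonUnitalSubalgebra F (Module.End F V)) :
    S ≤ scalarExtension S := fun T hT => ⟨0, by simpa using hT⟩

theorem one_mem_scalarExtension (S : NonUnitalSubalgebra F (Module.End F V)) :
    (1 : Module.End F V) ∈ scalarExtension S := ⟨1, by simp⟩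

theorem mul_mem_of_mem_scalarExtension {S : NonUnitalSubalgebra F (Module.End F V)}
    {a b : Module.End F V} (ha : a ∈ scalarExtension S) (hb : b ∈ S) : a * b ∈ S := by
  obtain ⟨c, hc⟩ := ha
  have : a * b = (a - c • 1) * b + c • b := by simp [sub_mul]
  rw [this]
  exact S.add_mem (S.mul_mem hc hb) (S.smul_mem c hb)

/-- A matrix over `F + S` is a scalar matrix modulo matrices over `S`. -/
theorem StablyAlgebraic.scalarExtension {S : NonUnitalSubalgebra F (Module.End F V)}
    (hS : StablyAlgebraic S) : StablyAlgebraic (scalarExtension S) := by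
  intro n M hM
  choose c hc using hM
  let K : Submodule F (Matrix (Fin n) (Fin n) (Module.End F V)) :=
    { carrier := {k | ∀ i j, k i j ∈ S}
      add_mem' := fun ha hb i j => S.add_mem (ha i j) (hb i j)
      zero_mem' := fun i j => S.zero_mem
      smul_mem' := fun c a ha i j => S.smul_mem c (ha i j) }
  let N : Matrix (Fin n) (Fin n) (Module.End F V) :=
    (Algebra.ofId F (Module.End F V)).mapMatrix (Matrix.of c)
  have hN : ∀ i j, N i j = c i j • 1 := fun i j => by
    simp [N, Algebra.ofId_apply, Algebra.algebraMap_eq_smul_one]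
  refine IsAlgebraic.of_sub_mem K (n := N) ?_ ?_ ?_ ?_ (fun k hk => hS n k hk)
  · exact IsAlgebraic.algHom _ (Algebra.IsAlgebraic.isAlgebraic _)
  · intro i j
    rw [Matrix.sub_apply, hN]; exact hc i j
  · intro k hk i j
    rw [Matrix.mul_apply]
    exact sum_mem fun l _ => mul_mem_of_mem_scalarExtension ⟨_, hc i l⟩ (hk l j)
  · intro k hk i j
    rw [Matrix.mul_apply]
    refine sum_mem fun l _ => ?_
    rw [hN, mul_smul_comm, mul_one]
    exact S.smul_mem _ (hk i l)

theorem stablyAlgebraic_range {A : Type*} [NonUnitalRing A] [Module F A] [IsScalarTower F A A]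
    [SMulCommClass F A A] (hA : IsStableAlgebraic F A) (ρ : A →ₙₐ[F] Module.End F V) :
    StablyAlgebraic (NonUnitalAlgHom.range ρ) := by
  intro n M hM
  choose a ha using hM
  let φ : Matrix (Fin n) (Fin n) A →ₙₐ[F] Matrix (Fin n) (Fin n) (Module.End F V) :=
    { toFun := fun N => N.map ρ
      map_smul' := fun c N => by ext1 i j; simp
      map_zero' := by ext1 i j; simp
      map_add' := fun N N' => by ext1 i j; simp
      map_mul' := fun N N' => by ext1 i j; simp [Matrix.mul_apply, map_sum] }
  have h := (hA n (Matrix.of a)).algHom (Unitization.lift φ)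
  have h2 : Unitization.lift φ (Unitization.inr (Matrix.of a)) = φ (Matrix.of a) := by simp
  rw [h2] at h
  convert h
  ext1 i j
  exact (ha i j).symm

end StablyAlgebraic

section RankIdeal

variable {F : Type*} [Field F] {V : Type*} [AddCommGroup V] [Module F V]
  (U : Type*) [AddCommGroup U] [Module F U]

/-- The operators `∑ uₖ ⊗ fₖ` on `U ⊗ V`, where `uₖ ∈ U` stands for the map `v ↦ uₖ ⊗ v` and the
row `fₖ : U ⊗ V → V` has all its entries `v ↦ fₖ (u ⊗ v)` in `S`. With respect to a basis of `U`,
these are the matrices over `S` whose rows span a finite-dimensional space. -/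
def rankIdeal (S : NonUnitalSubalgebra F (Module.End F V)) :
    NonUnitalSubalgebra F (Module.End F (U ⊗[F] V)) where
  carrier := {T | ∃ (q : ℕ) (u : Fin q → U) (f : Fin q → U ⊗[F] V →ₗ[F] V),
    (∀ k u', f k ∘ₗ TensorProduct.mk F U V u' ∈ S) ∧
      T = ∑ k, TensorProduct.mk F U V (u k) ∘ₗ f k}
  add_mem' := by
    rintro _ _ ⟨q, u, f, hf, rfl⟩ ⟨q', u', f', hf', rfl⟩
    refine ⟨q + q', Fin.append u u', Fin.append f f', ?_, ?_⟩
    · intro k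
      refine Fin.addCases (fun k => ?_) (fun k => ?_) k
      · simpa using hf k
      · simpa using hf' k
    · simp [Fin.sum_univ_add]
  zero_mem' := ⟨0, Fin.elim0, Fin.elim0, fun k => k.elim0, by simp⟩
  smul_mem' := by
    rintro c _ ⟨q, u, f, hf, rfl⟩
    refine ⟨q, u, fun k => c • f k, fun k u' => ?_, ?_⟩
    · rw [LinearMap.smul_comp]; exact S.smul_mem c (hf k u')
    · rw [Finset.smul_sum]; simp [LinearMap.comp_smul]
  mul_mem' := by
    rintro _ _ ⟨q, u, f, hf, rfl⟩ ⟨q', u', f', hf', rfl⟩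
    refine ⟨q, u, fun k => ∑ l, (f k ∘ₗ TensorProduct.mk F U V (u' l)) ∘ₗ f' l, ?_, ?_⟩
    · intro k w
      have : (∑ l, (f k ∘ₗ TensorProduct.mk F U V (u' l)) ∘ₗ f' l) ∘ₗ TensorProduct.mk F U V w =
          ∑ l, (f k ∘ₗ TensorProduct.mk F U V (u' l)) ∘ₗ (f' l ∘ₗ TensorProduct.mk F U V w) := by
        ext; simp
      rw [this]
      exact sum_mem fun l _ => S.mul_mem (hf k (u' l)) (hf' l w)
    · refine LinearMap.ext fun z => ?_
      simp [Module.End.mul_apply, map_sum]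
      exact Finset.sum_comm

variable {U}

theorem comp_mem_rankIdeal {S : NonUnitalSubalgebra F (Module.End F V)} (u : U)
    {f : U ⊗[F] V →ₗ[F] V} (hf : ∀ u', f ∘ₗ TensorProduct.mk F U V u' ∈ S) :
    (TensorProduct.mk F U V u ∘ₗ f : Module.End F (U ⊗[F] V)) ∈ rankIdeal U S :=
  ⟨1, fun _ => u, fun _ => f, fun _ => hf, by simp⟩

/-- A matrix `T` over `rankIdeal U S` factors as `T = g ∘ f` through a finite power of `V`, and
`f ∘ g` is a matrix over `S`. -/
theorem StablyAlgebraic.rankIdeal {S : NonUnitalSubalgebra F (Module.End F V)}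
    (hS : StablyAlgebraic S) : StablyAlgebraic (rankIdeal U S) := by
  intro n M hM
  choose q u f hf hMf using hM
  let ι := Σ (i : Fin n) (j : Fin n), Fin (q i j)
  let Φ : (Fin n → U ⊗[F] V) →ₗ[F] (ι → V) :=
    LinearMap.pi fun a => f a.1 a.2.1 a.2.2 ∘ₗ LinearMap.proj a.2.1
  let Ψ : (ι → V) →ₗ[F] (Fin n → U ⊗[F] V) :=
    LinearMap.pi fun i => ∑ j, ∑ k, TensorProduct.mk F U V (u i j k) ∘ₗ
      LinearMap.proj (⟨i, j, k⟩ : ι)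
  let N : Matrix ι ι (Module.End F V) := Matrix.of fun a b =>
    if a.2.1 = b.1 then f a.1 a.2.1 a.2.2 ∘ₗ TensorProduct.mk F U V (u b.1 b.2.1 b.2.2) else 0
  have hN : IsAlgebraic F N := by
    refine hS.isAlgebraic_matrix N fun a b => ?_
    simp only [N, Matrix.of_apply]
    split_ifs
    · exact hf _ _ _ _
    · exact S.zero_mem
  have h1 : (endVecAlgEquivMatrixEnd ι F F V).symm N = Φ ∘ₗ Ψ := by
    refine LinearMap.ext fun x => funext fun a => ?_
    change ∑ b, N a b (x b) = _
    simp only [Φ, Ψ, N, LinearMap.comp_apply, LinearMap.pi_apply, LinearMap.proj_apply,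
      LinearMap.sum_apply, Matrix.of_apply, ι]
    rw [Fintype.sum_sigma, Finset.sum_eq_single a.2.1]
    · rw [Fintype.sum_sigma]
      simp [map_sum]
    · intro i _ hi
      exact Finset.sum_eq_zero fun b _ => by rw [if_neg (Ne.symm hi)]; rfl
    · simp
  have h2 : (endVecAlgEquivMatrixEnd (Fin n) F F (U ⊗[F] V)).symm M = Ψ ∘ₗ Φ := by
    refine LinearMap.ext fun x => funext fun i => ?_
    change ∑ j, M i j (x j) = _
    simp [Φ, Ψ, hMf]
  have h3 : IsAlgebraic F (Φ ∘ₗ Ψ : Module.End F (ι → V)) := by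
    rw [← h1]; exact hN.algHom (endVecAlgEquivMatrixEnd ι F F V).symm.toAlgHom
  have h4 := h3.comp_swap
  rw [← h2] at h4
  simpa using h4.algHom (endVecAlgEquivMatrixEnd (Fin n) F F (U ⊗[F] V)).toAlgHom

theorem rTensor_mul_mem_rankIdeal {S : NonUnitalSubalgebra F (Module.End F V)}
    (n : Module.End F U) {T : Module.End F (U ⊗[F] V)} (hT : T ∈ rankIdeal U S) :
    n.rTensor V * T ∈ rankIdeal U S := by
  obtain ⟨q, u, f, hf, rfl⟩ := hT
  refine ⟨q, fun k => n (u k), f, hf, ?_⟩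
  refine LinearMap.ext fun z => ?_
  simp [Module.End.mul_apply, map_sum]

theorem mul_rTensor_mem_rankIdeal {S : NonUnitalSubalgebra F (Module.End F V)}
    (n : Module.End F U) {T : Module.End F (U ⊗[F] V)} (hT : T ∈ rankIdeal U S) :
    T * n.rTensor V ∈ rankIdeal U S := by
  obtain ⟨q, u, f, hf, rfl⟩ := hT
  refine ⟨q, u, fun k => f k ∘ₗ n.rTensor V, fun k u' => ?_, ?_⟩
  · have : (f k ∘ₗ n.rTensor V) ∘ₗ TensorProduct.mk F U V u' =
        f k ∘ₗ TensorProduct.mk F U V (n u') := by ext; simp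
    rw [this]; exact hf _ _
  · refine LinearMap.ext fun z => ?_
    simp [Module.End.mul_apply]

/-- The operators that agree with `n ⊗ 1`, for some `n ∈ N`, modulo `rankIdeal U S`. This is the
matrix wreath product of `S` and `N`. -/
def wreathProduct (N : NonUnitalSubalgebra F (Module.End F U))
    (S : NonUnitalSubalgebra F (Module.End F V)) :
    NonUnitalSubalgebra F (Module.End F (U ⊗[F] V)) where
  carrier := {T | ∃ n ∈ N, T - n.rTensor V ∈ rankIdeal U S}
  add_mem' := by
    rintro a b ⟨n, hn, h⟩ ⟨n', hn', h'⟩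
    refine ⟨n + n', N.add_mem hn hn', ?_⟩
    rw [LinearMap.rTensor_add, add_sub_add_comm]
    exact (rankIdeal U S).add_mem h h'
  zero_mem' := ⟨0, N.zero_mem, by simp⟩
  smul_mem' := by
    rintro c a ⟨n, hn, h⟩
    refine ⟨c • n, N.smul_mem c hn, ?_⟩
    rw [LinearMap.rTensor_smul, ← smul_sub]
    exact (rankIdeal U S).smul_mem c h
  mul_mem' := by
    rintro a b ⟨n, hn, h⟩ ⟨n', hn', h'⟩
    refine ⟨n * n', N.mul_mem hn hn', ?_⟩
    have : a * b - (n * n').rTensor V = n.rTensor V * (b - n'.rTensor V) +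
        (a - n.rTensor V) * n'.rTensor V + (a - n.rTensor V) * (b - n'.rTensor V) := by
      rw [LinearMap.rTensor_mul, mul_sub, mul_sub, sub_mul, sub_mul]; abel
    rw [this]
    exact (rankIdeal U S).add_mem ((rankIdeal U S).add_mem (rTensor_mul_mem_rankIdeal _ h')
      (mul_rTensor_mem_rankIdeal _ h)) ((rankIdeal U S).mul_mem h h')

theorem isAlgebraic_of_mem_wreathProduct {N : NonUnitalSubalgebra F (Module.End F U)}
    {S : NonUnitalSubalgebra F (Module.End F V)} (hN : ∀ n ∈ N, IsAlgebraic F n)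
    (hS : StablyAlgebraic S) {T : Module.End F (U ⊗[F] V)} (hT : T ∈ wreathProduct N S) :
    IsAlgebraic F T := by
  obtain ⟨n, hn, h⟩ := hT
  refine IsAlgebraic.of_sub_mem (rankIdeal U S).toSubmodule
    ((hN n hn).algHom (Module.End.rTensorAlgHom F U V)) h ?_ ?_ ?_
  · intro k hk
    have : T * k = n.rTensor V * k + (T - n.rTensor V) * k := by
      rw [sub_mul]; abel
    rw [this]
    exact (rankIdeal U S).add_mem (rTensor_mul_mem_rankIdeal _ hk) ((rankIdeal U S).mul_mem h hk)
  · intro k hk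
    exact mul_rTensor_mem_rankIdeal _ hk
  · intro k hk
    exact hS.rankIdeal.isAlgebraic hk

end RankIdeal

/-! ### Nil modules and the choice of a row -/

section Assignment

/-- Tasks that can each be fulfilled by a finite set of arbitrarily large numbers can be fulfilled
by pairwise disjoint finite sets. -/
theorem exists_disjoint_finsets {T : Type*} [Denumerable T] (P : T → Finset ℕ → Prop)
    (hP : ∀ t m, ∃ S, (∀ i ∈ S, m ≤ i) ∧ P t S) :
    ∃ S : T → Finset ℕ, (∀ t, P t (S t)) ∧ ∀ t t' i, i ∈ S t → i ∈ S t' → t = t' := by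
  choose f hf hfP using hP
  let e := (Denumerable.eqv T).symm
  let b : ℕ → ℕ := fun n => Nat.rec 0 (fun n m => max m ((f (e n) m).sup id + 1)) n
  have hb : ∀ n, b (n + 1) = max (b n) ((f (e n) (b n)).sup id + 1) := fun n => rfl
  have hmono : Monotone b := monotone_nat_of_le_succ fun n => by rw [hb]; exact le_max_left _ _
  have hlt : ∀ n, ∀ i ∈ f (e n) (b n), i < b (n + 1) := fun n i hi => by
    rw [hb]
    exact lt_of_lt_of_le (Nat.lt_succ_of_le (Finset.le_sup (f := id) hi)) (le_max_right _ _)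
  have hdisj : ∀ n n' i, i ∈ f (e n) (b n) → i ∈ f (e n') (b n') → ¬ n < n' := by
    intro n n' i hi hi' hn
    have h1 := hlt n i hi
    have h2 := hf _ _ i hi'
    have h3 : b (n + 1) ≤ b n' := hmono hn
    omega
  refine ⟨fun t => f t (b (e.symm t)), fun t => hfP _ _, fun t t' i hi hi' => ?_⟩
  have h1 := hdisj (e.symm t) (e.symm t') i (by simpa using hi) (by simpa using hi')
  have h2 := hdisj (e.symm t') (e.symm t) i (by simpa using hi') (by simpa using hi)
  exact e.symm.injective (by omega)

variable {F : Type*} [Field F]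

/-- The properties of the operators `x`, `y` on `F^(ℕ)` and of the basis vector `e_o` that are
required of the nil module: every element of the algebra generated by `x` and `y` is nilpotent,
`e_o` generates the module, `y` kills `e_o`, and each coordinate functional is a linear combination
of functionals `e_i^* ∘ n` with `e_i^* ∘ y = 0` and `i` as large as desired. -/
structure IsNilModule (x y : Module.End F (ℕ →₀ F)) (o : ℕ) : Prop where
  isNilpotent : ∀ n ∈ NonUnitalAlgebra.adjoin F {x, y}, IsNilpotent n
  y_apply : y (Finsupp.single o 1) = 0
  x_coord : ∀ u, x u o = 0
  y_coord : ∀ u, y u o = 0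
  cyclic : ∀ W : Submodule F (ℕ →₀ F), Finsupp.single o 1 ∈ W → (∀ u ∈ W, x u ∈ W ∧ y u ∈ W) →
    W = ⊤
  coord_mem_span : ∀ j m, (Finsupp.lapply j : (ℕ →₀ F) →ₗ[F] F) ∈ Submodule.span F
    {f | ∃ i ≥ m, (∀ u, y u i = 0) ∧ ∃ n ∈ NonUnitalAlgebra.adjoin F {x, y},
      f = (Finsupp.lapply i : (ℕ →₀ F) →ₗ[F] F) ∘ₗ n}

/-- Data for a row of operators on `F^(ℕ) ⊗ V` with the entries `E_{p i, κ i} ⊗ r i`, apart from the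
entry at `o`, which is to be the identity. The indices `i ∈ fn` serve to isolate the `i`-th entry:
among all nonzero entries, only this one has a nonzero `i`-th row, and it equals `E_{i, κ i} ⊗ 1`
with `κ i < i`. The other indices supply all `E_{q, k} ⊗ a t` with `q ∉ fn`. -/
structure IsRowData {R : Type*} [Ring R] (x y : Module.End F (ℕ →₀ F)) (o : ℕ) (a : ℕ → R)
    (fn : Set ℕ) (p κ : ℕ → ℕ) (r : ℕ → R) : Prop where
  r_mem : ∀ i, r i = 0 ∨ r i = 1 ∨ ∃ t, r i = a t
  y_coord : ∀ i, r i ≠ 0 → ∀ u, y u i = 0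
  origin : o ∉ fn
  fn_p : ∀ i ∈ fn, p i = i
  fn_κ : ∀ i ∈ fn, κ i < i
  fn_r : ∀ i ∈ fn, r i = 1
  unique : ∀ i, r i ≠ 0 → p i ∈ fn → p i = i
  coord_mem_span : ∀ j l, (Finsupp.lapply j : (ℕ →₀ F) →ₗ[F] F) ∈ Submodule.span F
    {f | ∃ i ∈ fn, κ i = l ∧ ∃ n ∈ NonUnitalAlgebra.adjoin F {x, y},
      f = (Finsupp.lapply i : (ℕ →₀ F) →ₗ[F] F) ∘ₗ n}
  free : ∀ t q k, q ∉ fn → ∃ i, i ≠ o ∧ p i = q ∧ κ i = k ∧ r i = a t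

/-- The tasks `inl (j, l)` ask for a finite set of indices `i > l` whose functionals `e_i^* ∘ n`
span `e_j^*`; the tasks `inr (t, q, k)` ask for a single index that supplies `E_{q, k} ⊗ a t`. They
are fulfilled by disjoint sets. -/
theorem IsNilModule.exists_isRowData {x y : Module.End F (ℕ →₀ F)} {o : ℕ}
    (h : IsNilModule x y o) {R : Type*} [Ring R] (a : ℕ → R) :
    ∃ fn p κ r, IsRowData x y o a fn p κ r := by
  classical
  let span (j : ℕ) (S : Set ℕ) : Prop := (Finsupp.lapply j : (ℕ →₀ F) →ₗ[F] F) ∈ Submodule.span F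
    {f | ∃ i ∈ S, ∃ n ∈ NonUnitalAlgebra.adjoin F {x, y},
      f = (Finsupp.lapply i : (ℕ →₀ F) →ₗ[F] F) ∘ₗ n}
  let P : (ℕ × ℕ) ⊕ (ℕ × ℕ × ℕ) → Finset ℕ → Prop := fun t S =>
    (∀ i ∈ S, o < i ∧ ∀ u, y u i = 0) ∧
      Sum.elim (fun jl => span jl.1 S ∧ ∀ i ∈ S, jl.2 < i) (fun _ => S.Nonempty) t
  have hfin : ∀ j m, ∃ S : Finset ℕ, (∀ i ∈ S, m ≤ i ∧ ∀ u, y u i = 0) ∧ span j S := by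
    intro j m
    obtain ⟨s, hs, hj⟩ := Submodule.mem_span_finite_of_mem_span (h.coord_mem_span j m)
    have hs' : ∀ f ∈ s, ∃ i ≥ m, (∀ u, y u i = 0) ∧
        ∃ n ∈ NonUnitalAlgebra.adjoin F {x, y}, f = Finsupp.lapply i ∘ₗ n := fun f hf => hs hf
    choose! i hi hy n hn hf using hs'
    refine ⟨s.image i, ?_, Submodule.span_mono ?_ hj⟩
    · intro k hk
      obtain ⟨f, hfs, rfl⟩ := Finset.mem_image.1 hk
      exact ⟨hi f hfs, hy f hfs⟩
    · intro f hfs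
      exact ⟨i f, Finset.mem_coe.2 (Finset.mem_image_of_mem i hfs), n f, hn f hfs, hf f hfs⟩
  have hP : ∀ t m, ∃ S, (∀ i ∈ S, m ≤ i) ∧ P t S := by
    rintro (⟨j, l⟩ | t) m
    · obtain ⟨S, hS, hj⟩ := hfin j (m + o + l + 1)
      refine ⟨S, fun i hi => ?_, fun i hi => ⟨?_, (hS i hi).2⟩, hj, fun i hi => ?_⟩ <;>
      · have := (hS i hi).1
        omega
    · obtain ⟨S, hS, hj⟩ := hfin 0 (m + o + 1)
      refine ⟨S, fun i hi => ?_, fun i hi => ⟨?_, (hS i hi).2⟩, ?_⟩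
      · have := (hS i hi).1; omega
      · have := (hS i hi).1; omega
      · -- The coordinate functional is nonzero, so the spanning set is nonempty.
        by_contra hne
        rw [Sum.elim_inr, Finset.not_nonempty_iff_eq_empty] at hne
        subst hne
        simp only [span, Finset.coe_empty, Set.mem_empty_iff_false, false_and, exists_false,
          Set.ofPred_false, Submodule.span_empty, Submodule.mem_bot] at hj
        have := LinearMap.congr_fun hj (Finsupp.single 0 1)
        simp at this
  obtain ⟨S, hSP, hS⟩ := exists_disjoint_finsets P hP
  let fn : Set ℕ := {i | ∃ jl, i ∈ S (Sum.inl jl)}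
  -- The finite sets are disjoint, so that each `i` is assigned to at most one task.
  have hex : ∀ i, ∃ d : ℕ × ℕ × R, (∀ jl, i ∈ S (Sum.inl jl) → d = (i, jl.2, 1)) ∧
      (∀ t q k, i ∈ S (Sum.inr (t, q, k)) → q ∉ fn → d = (q, k, a t)) ∧
      (d.2.2 ≠ 0 → ∃ τ, i ∈ S τ) ∧ (d.2.2 = 0 ∨ d.2.2 = 1 ∨ ∃ t, d.2.2 = a t) ∧
      (d.2.2 ≠ 0 → d.1 ∈ fn → d.1 = i) := by
    intro i
    by_cases hi : ∃ τ, i ∈ S τ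
    · obtain ⟨τ, hτ⟩ := hi
      rcases τ with jl | ⟨t, q, k⟩
      · refine ⟨(i, jl.2, 1), fun jl' h' => ?_, fun t q k h' _ => ?_, fun _ => ⟨_, hτ⟩,
          Or.inr (Or.inl rfl), fun _ _ => rfl⟩
        · rw [Sum.inl_injective (hS _ _ _ hτ h')]
        · exact absurd (hS _ _ _ hτ h') (by simp)
      · by_cases hq : q ∈ fn
        · refine ⟨(q, k, 0), fun jl' h' => ?_, fun t' q' k' h' hq' => ?_, by simp, by simp, by simp⟩
          · exact absurd (hS _ _ _ hτ h') (by simp)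
          · have := Sum.inr_injective (hS _ _ _ hτ h')
            simp only [Prod.mk.injEq] at this
            exact absurd (this.2.1 ▸ hq) hq'
        · refine ⟨(q, k, a t), fun jl' h' => ?_, fun t' q' k' h' _ => ?_, fun _ => ⟨_, hτ⟩,
            Or.inr (Or.inr ⟨t, rfl⟩), fun _ h' => absurd h' hq⟩
          · exact absurd (hS _ _ _ hτ h') (by simp)
          · have := Sum.inr_injective (hS _ _ _ hτ h')
            simp only [Prod.mk.injEq] at this
            obtain ⟨rfl, rfl, rfl⟩ := this
            rfl
    · refine ⟨(0, 0, 0), fun jl' h' => absurd ⟨_, h'⟩ hi, fun t' q' k' h' _ => absurd ⟨_, h'⟩ hi,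
        by simp, by simp, by simp⟩
  choose d hd1 hd2 hd3 hd4 hd5 using hex
  refine ⟨fn, fun i => (d i).1, fun i => (d i).2.1, fun i => (d i).2.2, hd4, ?_, ?_, ?_, ?_, ?_,
    hd5, ?_, ?_⟩
  · intro i hi
    obtain ⟨τ, hτ⟩ := hd3 i hi
    exact ((hSP τ).1 i hτ).2
  · rintro ⟨jl, hjl⟩
    exact lt_irrefl _ ((hSP _).1 _ hjl).1
  · rintro i ⟨jl, hjl⟩
    simp [hd1 i jl hjl]
  · rintro i ⟨jl, hjl⟩
    rw [hd1 i jl hjl]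
    exact (hSP (Sum.inl jl)).2.2 i hjl
  · rintro i ⟨jl, hjl⟩
    simp [hd1 i jl hjl]
  · intro j l
    refine Submodule.span_mono ?_ (hSP (Sum.inl (j, l))).2.1
    rintro f ⟨i, hi, n, hn, hf⟩
    exact ⟨i, ⟨_, hi⟩, by rw [hd1 i (j, l) hi], n, hn, hf⟩
  · intro t q k hq
    obtain ⟨i, hi⟩ : (S (Sum.inr (t, q, k))).Nonempty := (hSP (Sum.inr (t, q, k))).2
    refine ⟨i, ((hSP _).1 i hi).1.ne', ?_⟩
    simp [hd2 i t q k hi hq]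

end Assignment

/-! ### Matrix units on tensor products -/

section MatrixUnits

variable {F : Type*} [Field F]

/-- The matrix unit `E_{i,j}` as an operator on `F^(ℕ)`. -/
noncomputable def matUnit (F : Type*) [Field F] (i j : ℕ) : Module.End F (ℕ →₀ F) :=
  (Finsupp.lapply j : (ℕ →₀ F) →ₗ[F] F).smulRight (Finsupp.single i 1)

theorem matUnit_apply (i j : ℕ) (u : ℕ →₀ F) :
    matUnit F i j u = u j • Finsupp.single i 1 := rfl

theorem matUnit_mul_same (i j l : ℕ) : matUnit F i j * matUnit F j l = matUnit F i l := by
  refine LinearMap.ext fun u => ?_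
  simp [Module.End.mul_apply, matUnit_apply]

theorem matUnit_mul_of_ne (i l : ℕ) {j k : ℕ} (h : j ≠ k) :
    matUnit F i j * matUnit F k l = 0 := by
  refine LinearMap.ext fun u => ?_
  simp [Module.End.mul_apply, matUnit_apply, h]

variable {V : Type*} [AddCommGroup V] [Module F V]

/-- `E_{p,q} ⊗ a` as an operator on `F^(ℕ) ⊗ F^(ℕ) ⊗ V`, for `p` and `q` in `ℕ × ℕ`. -/
noncomputable def blockUnit (p q : ℕ × ℕ) :
    Module.End F V →ₗ[F] Module.End F ((ℕ →₀ F) ⊗[F] ((ℕ →₀ F) ⊗[F] V)) :=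
  TensorProduct.mapBilinear (.id F) _ _ _ _ (matUnit F p.1 q.1) ∘ₗ
    TensorProduct.mapBilinear (.id F) _ _ _ _ (matUnit F p.2 q.2)

theorem blockUnit_apply (p q : ℕ × ℕ) (a : Module.End F V) :
    blockUnit p q a = TensorProduct.map (matUnit F p.1 q.1)
      (TensorProduct.map (matUnit F p.2 q.2) a) := rfl

theorem blockUnit_mul_same (p q r : ℕ × ℕ) (a b : Module.End F V) :
    blockUnit p q a * blockUnit q r b = blockUnit p r (a * b) := by
  simp only [blockUnit_apply, ← TensorProduct.map_mul, matUnit_mul_same]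

theorem blockUnit_mul_of_ne (p r : ℕ × ℕ) {q q' : ℕ × ℕ} (h : q ≠ q') (a b : Module.End F V) :
    blockUnit p q a * blockUnit q' r b = 0 := by
  simp only [blockUnit_apply, ← TensorProduct.map_mul]
  by_cases h1 : q.1 = q'.1
  · have h2 : q.2 ≠ q'.2 := fun h2 => h (Prod.ext h1 h2)
    rw [matUnit_mul_of_ne _ _ h2, TensorProduct.map_zero_left, TensorProduct.map_zero_right]
  · rw [matUnit_mul_of_ne _ _ h1, TensorProduct.map_zero_left]

/-- The coordinate with index `q` of an element of `F^(ℕ) ⊗ F^(ℕ) ⊗ V`. -/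
noncomputable def blockCoord (q : ℕ × ℕ) : (ℕ →₀ F) ⊗[F] ((ℕ →₀ F) ⊗[F] V) →ₗ[F] V :=
  (TensorProduct.lid F V).toLinearMap ∘ₗ (Finsupp.lapply q.2 : (ℕ →₀ F) →ₗ[F] F).rTensor V ∘ₗ
    (TensorProduct.lid F ((ℕ →₀ F) ⊗[F] V)).toLinearMap ∘ₗ
      (Finsupp.lapply q.1 : (ℕ →₀ F) →ₗ[F] F).rTensor ((ℕ →₀ F) ⊗[F] V)

/-- The element of `F^(ℕ) ⊗ F^(ℕ) ⊗ V` whose only coordinate is `v`, with index `p`. -/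
noncomputable def blockSingle (p : ℕ × ℕ) : V →ₗ[F] (ℕ →₀ F) ⊗[F] ((ℕ →₀ F) ⊗[F] V) :=
  TensorProduct.mk F (ℕ →₀ F) _ (Finsupp.single p.1 1) ∘ₗ
    TensorProduct.mk F (ℕ →₀ F) V (Finsupp.single p.2 1)

theorem blockUnit_apply_apply (p q : ℕ × ℕ) (a : Module.End F V)
    (z : (ℕ →₀ F) ⊗[F] ((ℕ →₀ F) ⊗[F] V)) :
    blockUnit p q a z = blockSingle p (a (blockCoord q z)) := by
  have : blockUnit p q a = blockSingle p ∘ₗ a ∘ₗ blockCoord q := by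
    ext i j v
    simp only [blockUnit_apply, blockSingle, blockCoord, matUnit_apply, LinearMap.comp_apply,
      TensorProduct.AlgebraTensorModule.curry_apply, TensorProduct.curry_apply,
      LinearMap.restrictScalars_apply, TensorProduct.map_tmul, LinearMap.rTensor_tmul,
      LinearEquiv.coe_coe, TensorProduct.lid_tmul, TensorProduct.mk_apply, Finsupp.lapply_apply,
      Finsupp.lsingle_apply, map_smul, ← TensorProduct.smul_tmul', TensorProduct.tmul_smul]
    rw [smul_comm]
  rw [this]; rfl

theorem blockCoord_blockSingle_same (p : ℕ × ℕ) (v : V) :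
    blockCoord p (blockSingle (F := F) p v) = v := by
  simp [blockSingle, blockCoord]

theorem blockCoord_blockSingle_of_ne {p q : ℕ × ℕ} (h : q ≠ p) (v : V) :
    blockCoord p (blockSingle (F := F) q v) = 0 := by
  by_cases h1 : q.1 = p.1
  · have h2 : q.2 ≠ p.2 := fun h2 => h (Prod.ext h1 h2)
    simp [blockSingle, blockCoord, h2]
  · simp [blockSingle, blockCoord, h1]

theorem span_blockSingle (W : Submodule F ((ℕ →₀ F) ⊗[F] ((ℕ →₀ F) ⊗[F] V)))
    (h : ∀ p v, blockSingle p v ∈ W) : W = ⊤ := by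
  rw [eq_top_iff]
  rintro z -
  induction z with
  | zero => exact W.zero_mem
  | add a b ha hb => exact W.add_mem ha hb
  | tmul u z =>
    induction u using Finsupp.induction_linear with
    | zero => simp
    | add u u' hu hu' => rw [TensorProduct.add_tmul]; exact W.add_mem hu hu'
    | single i c =>
      have : Finsupp.single i c = c • Finsupp.single i (1 : F) := by simp
      rw [this, ← TensorProduct.smul_tmul']
      refine W.smul_mem _ ?_
      induction z with
      | zero => simp
      | add a b ha hb => rw [TensorProduct.tmul_add]; exact W.add_mem ha hb
      | tmul u v =>
        induction u using Finsupp.induction_linear with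
        | zero => simp
        | add u u' hu hu' =>
          rw [TensorProduct.add_tmul, TensorProduct.tmul_add]; exact W.add_mem hu hu'
        | single j c =>
          have : Finsupp.single j c = c • Finsupp.single j (1 : F) := by simp
          rw [this, ← TensorProduct.smul_tmul', TensorProduct.tmul_smul]
          exact W.smul_mem _ (h (i, j) v)

theorem exists_blockCoord_ne_zero {z : (ℕ →₀ F) ⊗[F] ((ℕ →₀ F) ⊗[F] V)} (hz : z ≠ 0) :
    ∃ p, blockCoord p z ≠ 0 := by
  by_contra! h
  refine hz ((TensorProduct.finsuppScalarLeft F _ ℕ).injective (Finsupp.ext fun i => ?_))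
  refine (TensorProduct.finsuppScalarLeft F _ ℕ).injective (Finsupp.ext fun j => ?_)
  rw [TensorProduct.finsuppScalarLeft_apply, TensorProduct.finsuppScalarLeft_apply]
  simpa [blockCoord] using h (i, j)

end MatrixUnits

/-! ### Operators with a single row -/

section RowOperator

variable {F : Type*} [Field F] {U W : Type*} [AddCommGroup U] [Module F U]
  [AddCommMonoid W] [Module F W]

/-- The operator on `U ⊗ W` with the single row `γ`, in position `w`: it maps `u ⊗ v` to
`w ⊗ γ(u) v`. -/
noncomputable def rowOp (γ : U →ₗ[F] Module.End F W) (w : U) : Module.End F (U ⊗[F] W) :=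
  TensorProduct.mk F U W w ∘ₗ TensorProduct.lift γ

theorem rowOp_mul_self {γ : U →ₗ[F] Module.End F W} {w : U} (hw : γ w = 1) :
    rowOp γ w * rowOp γ w = rowOp γ w := by
  refine LinearMap.ext fun z => ?_
  simp [rowOp, Module.End.mul_apply, hw]

theorem rTensor_mul_rowOp {γ : U →ₗ[F] Module.End F W} {w : U} {y : Module.End F U}
    (hy : y w = 0) : y.rTensor W * rowOp γ w = 0 := by
  refine LinearMap.ext fun z => ?_
  simp [rowOp, Module.End.mul_apply, hy]

theorem rowOp_mul_rTensor {γ : U →ₗ[F] Module.End F W} {w : U} {y : Module.End F U}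
    (hy : ∀ u, γ (y u) = 0) : rowOp γ w * y.rTensor W = 0 := by
  ext u v
  simp [rowOp, Module.End.mul_apply, hy]

/-- The summands `y ⊗ 1` and `c = rowOp γ w` annihilate each other and `c` is idempotent. -/
theorem pow_rTensor_add_rowOp {γ : U →ₗ[F] Module.End F W} {w : U} {y : Module.End F U}
    (hw : γ w = 1) (hyw : y w = 0) (hy : ∀ u, γ (y u) = 0) (k : ℕ) :
    (y.rTensor W + rowOp γ w) ^ (k + 1) = (y ^ (k + 1)).rTensor W + rowOp γ w := by
  induction k with
  | zero => simp
  | succ k ih =>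
    have h1 : rowOp γ w * (y ^ (k + 1)).rTensor W = 0 := by
      rw [pow_succ', LinearMap.rTensor_mul, ← mul_assoc, rowOp_mul_rTensor hy, zero_mul]
    rw [pow_succ' _ (k + 1), ih, add_mul, mul_add, mul_add, rTensor_mul_rowOp hyw,
      rowOp_mul_self hw, h1, pow_succ' y (k + 1), LinearMap.rTensor_mul]
    simp

end RowOperator

section Row

variable {F : Type*} [Field F] {V : Type*} [AddCommGroup V] [Module F V]

/-- The row with entry `1` at `e_o` and entry `E_{p i, κ i} ⊗ r i` at `e_i` for `i ≠ o`. -/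
noncomputable def row (o : ℕ) (p κ : ℕ → ℕ) (r : ℕ → Module.End F V) :
    (ℕ →₀ F) →ₗ[F] Module.End F ((ℕ →₀ F) ⊗[F] V) :=
  Finsupp.linearCombination F fun i =>
    if i = o then 1 else TensorProduct.map (matUnit F (p i) (κ i)) (r i)

theorem row_single_origin (o : ℕ) (p κ : ℕ → ℕ) (r : ℕ → Module.End F V) :
    row o p κ r (Finsupp.single o 1) = 1 := by
  simp [row]

theorem row_single_of_ne {o i : ℕ} (h : i ≠ o) (p κ : ℕ → ℕ) (r : ℕ → Module.End F V) :
    row o p κ r (Finsupp.single i 1) = TensorProduct.map (matUnit F (p i) (κ i)) (r i) := by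
  simp [row, h]

variable {x y : Module.End F (ℕ →₀ F)} {o : ℕ} {a : ℕ → Module.End F V} {fn : Set ℕ}
  {p κ : ℕ → ℕ} {r : ℕ → Module.End F V}

theorem row_y_apply (hM : IsNilModule x y o) (hD : IsRowData x y o a fn p κ r) (u : ℕ →₀ F) :
    row o p κ r (y u) = 0 := by
  rw [row, Finsupp.linearCombination_apply, Finsupp.sum]
  refine Finset.sum_eq_zero fun i _ => ?_
  split_ifs with h
  · rw [h, hM.y_coord, zero_smul]
  · by_cases hr : r i = 0
    · rw [hr, TensorProduct.map_zero_right, smul_zero]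
    · rw [hD.y_coord i hr, zero_smul]

theorem map_matUnit_mem_rankIdeal {S : NonUnitalSubalgebra F (Module.End F V)} (i j : ℕ)
    {s : Module.End F V} (hs : s ∈ S) :
    TensorProduct.map (matUnit F i j) s ∈ rankIdeal (ℕ →₀ F) S := by
  have : TensorProduct.map (matUnit F i j) s = TensorProduct.mk F (ℕ →₀ F) V (Finsupp.single i 1) ∘ₗ
      (TensorProduct.lid F V).toLinearMap ∘ₗ
        TensorProduct.map (Finsupp.lapply j : (ℕ →₀ F) →ₗ[F] F) s := by
    refine TensorProduct.ext' fun u v => ?_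
    simp only [matUnit_apply, TensorProduct.map_tmul, ← TensorProduct.smul_tmul',
      LinearMap.comp_apply, LinearEquiv.coe_coe, TensorProduct.lid_tmul, map_smul,
      TensorProduct.mk_apply, Finsupp.lapply_apply]
  rw [this]
  refine comp_mem_rankIdeal _ fun u' => ?_
  have : ((TensorProduct.lid F V).toLinearMap ∘ₗ
      TensorProduct.map (Finsupp.lapply j : (ℕ →₀ F) →ₗ[F] F) s) ∘ₗ
        TensorProduct.mk F (ℕ →₀ F) V u' = u' j • s := by
    ext v; simp
  rw [this]
  exact S.smul_mem _ hs

theorem row_mem_scalarExtension (hD : IsRowData x y o a fn p κ r)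
    {S : NonUnitalSubalgebra F (Module.End F V)} (ha : ∀ t, a t ∈ S) (u : ℕ →₀ F) :
    row o p κ r u ∈ scalarExtension (rankIdeal (ℕ →₀ F) (scalarExtension S)) := by
  rw [row, Finsupp.linearCombination_apply, Finsupp.sum]
  refine sum_mem fun i _ => SMulMemClass.smul_mem _ ?_
  split_ifs with h
  · exact one_mem_scalarExtension _
  · refine le_scalarExtension _ (map_matUnit_mem_rankIdeal _ _ ?_)
    rcases hD.r_mem i with h | h | ⟨t, h⟩ <;> rw [h]
    · exact zero_mem _
    · exact one_mem_scalarExtension _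
    · exact le_scalarExtension _ (ha t)

/-- Multiplied by `E_{q,i} ⊗ b` with `i ∈ fn`, the row retains its entries at `e_o` and `e_i`
only. -/
theorem map_matUnit_mul_row (hD : IsRowData x y o a fn p κ r) {i : ℕ} (hi : i ∈ fn) (q : ℕ)
    (b : Module.End F V) (u : ℕ →₀ F) :
    TensorProduct.map (matUnit F q i) b * row o p κ r u =
      u o • TensorProduct.map (matUnit F q i) b +
        u i • TensorProduct.map (matUnit F q (κ i)) b := by
  have hio : i ≠ o := fun h => hD.origin (h ▸ hi)
  induction u using Finsupp.induction_linear with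
  | zero => simp
  | add u u' hu hu' =>
    rw [map_add, mul_add, hu, hu', Finsupp.add_apply, Finsupp.add_apply, add_smul, add_smul]
    abel
  | single j c =>
    have hc : Finsupp.single j c = c • Finsupp.single j (1 : F) := by simp
    rw [hc, map_smul, mul_smul_comm, Finsupp.smul_apply, Finsupp.smul_apply, smul_assoc, smul_assoc,
      ← smul_add]
    congr 1
    by_cases hj : j = o
    · rw [hj, row_single_origin]; simp [hio]
    rw [row_single_of_ne hj, Finsupp.single_eq_of_ne (Ne.symm hj), zero_smul, zero_add,
      ← TensorProduct.map_mul]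
    by_cases hij : j = i
    · subst hij
      rw [hD.fn_p j hi, hD.fn_r j hi, matUnit_mul_same]
      simp
    · rw [Finsupp.single_eq_of_ne (Ne.symm hij), zero_smul]
      by_cases hpj : i = p j
      · have hr : r j = 0 := by
          by_contra hr
          exact hij ((hD.unique j hr (hpj ▸ hi)).symm.trans hpj.symm)
        rw [hr, mul_zero, TensorProduct.map_zero_right]
      · rw [matUnit_mul_of_ne _ _ hpj, TensorProduct.map_zero_left]

end Row

section Generation

variable {F : Type*} [Field F] {V : Type*} [AddCommGroup V] [Module F V]
  {x y : Module.End F (ℕ →₀ F)} {o : ℕ} {a : ℕ → Module.End F V} {fn : Set ℕ}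
  {p κ : ℕ → ℕ} {r : ℕ → Module.End F V}

theorem IsNilModule.coord_origin (hM : IsNilModule x y o) {n : Module.End F (ℕ →₀ F)}
    (hn : n ∈ NonUnitalAlgebra.adjoin F {x, y}) : ∀ u, n u o = 0 := by
  induction hn using NonUnitalAlgebra.adjoin_induction with
  | mem n h =>
    rcases h with rfl | rfl
    · exact hM.x_coord
    · exact hM.y_coord
  | add n n' _ _ h h' => intro u; simp [h, h']
  | zero => intro u; rfl
  | mul n n' _ _ h h' => intro u; exact h _
  | smul c n _ h => intro u; simp [h]

theorem rTensor_mem {W : Type*} [AddCommMonoid W] [Module F W]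
    {B : NonUnitalSubalgebra F (Module.End F ((ℕ →₀ F) ⊗[F] W))}
    (hx : x.rTensor W ∈ B) (hy : y.rTensor W ∈ B) {n : Module.End F (ℕ →₀ F)}
    (hn : n ∈ NonUnitalAlgebra.adjoin F {x, y}) : n.rTensor W ∈ B := by
  induction hn using NonUnitalAlgebra.adjoin_induction with
  | mem n h =>
    rcases h with rfl | rfl
    · exact hx
    · exact hy
  | add n n' _ _ h h' => rw [LinearMap.rTensor_add]; exact B.add_mem h h'
  | zero => simp
  | mul n n' _ _ h h' => rw [LinearMap.rTensor_mul]; exact B.mul_mem h h'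
  | smul c n _ h => rw [LinearMap.rTensor_smul]; exact B.smul_mem _ h

/-- For operators of the form `u ⊗ f`, the vector `e_o` can be replaced by any other vector. -/
theorem mk_comp_mem (hM : IsNilModule x y o) {W : Type*} [AddCommMonoid W] [Module F W]
    {B : NonUnitalSubalgebra F (Module.End F ((ℕ →₀ F) ⊗[F] W))}
    (hx : x.rTensor W ∈ B) (hy : y.rTensor W ∈ B) {f : (ℕ →₀ F) ⊗[F] W →ₗ[F] W}
    (hf : TensorProduct.mk F (ℕ →₀ F) W (Finsupp.single o (1 : F)) ∘ₗ f ∈ B) (u : ℕ →₀ F) :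
    TensorProduct.mk F (ℕ →₀ F) W u ∘ₗ f ∈ B := by
  let T : Submodule F (ℕ →₀ F) :=
    { carrier := {u | TensorProduct.mk F (ℕ →₀ F) W u ∘ₗ f ∈ B}
      add_mem' := fun {u u'} h h' => by
        change TensorProduct.mk F (ℕ →₀ F) W (u + u') ∘ₗ f ∈ B
        rw [map_add, LinearMap.add_comp]
        exact B.add_mem h h'
      zero_mem' := by
        change TensorProduct.mk F (ℕ →₀ F) W 0 ∘ₗ f ∈ B
        rw [map_zero, LinearMap.zero_comp]
        exact B.zero_mem
      smul_mem' := fun c u h => by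
        change TensorProduct.mk F (ℕ →₀ F) W (c • u) ∘ₗ f ∈ B
        rw [map_smul, LinearMap.smul_comp]
        exact B.smul_mem _ h }
  have hT : T = ⊤ := by
    refine hM.cyclic T hf fun u hu => ⟨?_, ?_⟩
    · have : TensorProduct.mk F (ℕ →₀ F) W (x u) ∘ₗ f =
          x.rTensor W * (TensorProduct.mk F (ℕ →₀ F) W u ∘ₗ f) := by
        refine LinearMap.ext fun z => ?_
        simp [Module.End.mul_apply]
      change TensorProduct.mk F (ℕ →₀ F) W (x u) ∘ₗ f ∈ B
      rw [this]; exact B.mul_mem hx hu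
    · have : TensorProduct.mk F (ℕ →₀ F) W (y u) ∘ₗ f =
          y.rTensor W * (TensorProduct.mk F (ℕ →₀ F) W u ∘ₗ f) := by
        refine LinearMap.ext fun z => ?_
        simp [Module.End.mul_apply]
      change TensorProduct.mk F (ℕ →₀ F) W (y u) ∘ₗ f ∈ B
      rw [this]; exact B.mul_mem hy hu
  have : u ∈ T := by rw [hT]; trivial
  exact this

/-- The operators `s` such that `B` contains `s` times the row `γ`, in position `e_o`, are stable
under left multiplication by the entries of `γ`. -/
theorem rowOp_entry_mul_mem (hM : IsNilModule x y o) {W : Type*} [AddCommMonoid W] [Module F W]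
    {B : NonUnitalSubalgebra F (Module.End F ((ℕ →₀ F) ⊗[F] W))}
    {γ : (ℕ →₀ F) →ₗ[F] Module.End F W}
    (hx : x.rTensor W ∈ B) (hy : y.rTensor W ∈ B) (hc : rowOp γ (Finsupp.single o (1 : F)) ∈ B)
    {s : Module.End F W}
    (hs : TensorProduct.mk F (ℕ →₀ F) W (Finsupp.single o (1 : F)) ∘ₗ s ∘ₗ TensorProduct.lift γ ∈ B)
    (u : ℕ →₀ F) :
    TensorProduct.mk F (ℕ →₀ F) W (Finsupp.single o 1) ∘ₗ (γ u * s) ∘ₗ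
      TensorProduct.lift γ ∈ B := by
  have h := B.mul_mem hc (mk_comp_mem hM hx hy hs u)
  have e : rowOp γ (Finsupp.single o (1 : F)) *
      (TensorProduct.mk F (ℕ →₀ F) W u ∘ₗ s ∘ₗ TensorProduct.lift γ) =
        TensorProduct.mk F (ℕ →₀ F) W (Finsupp.single o 1) ∘ₗ (γ u * s) ∘ₗ
          TensorProduct.lift γ := by
    refine LinearMap.ext fun z => ?_
    simp [rowOp, Module.End.mul_apply]
  rwa [e] at h

theorem rowOp_entry_mem (hM : IsNilModule x y o) {W : Type*} [AddCommMonoid W] [Module F W]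
    {B : NonUnitalSubalgebra F (Module.End F ((ℕ →₀ F) ⊗[F] W))}
    {γ : (ℕ →₀ F) →ₗ[F] Module.End F W}
    (hx : x.rTensor W ∈ B) (hy : y.rTensor W ∈ B) (hc : rowOp γ (Finsupp.single o (1 : F)) ∈ B)
    (u : ℕ →₀ F) :
    TensorProduct.mk F (ℕ →₀ F) W (Finsupp.single o 1) ∘ₗ (γ u) ∘ₗ
      TensorProduct.lift γ ∈ B := by
  have hc' : TensorProduct.mk F (ℕ →₀ F) W (Finsupp.single o (1 : F)) ∘ₗ (1 : Module.End F W) ∘ₗ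
      TensorProduct.lift γ ∈ B := hc
  have := rowOp_entry_mul_mem hM hx hy hc hc' u
  rwa [mul_one] at this

variable {B : NonUnitalSubalgebra F (Module.End F ((ℕ →₀ F) ⊗[F] ((ℕ →₀ F) ⊗[F] V)))}

/-- If `q ∉ fn` then `E_{q,k} ⊗ b` is a combination of entries of the row. If `q ∈ fn`, then it
is the product of the entry `E_{q, κ q} ⊗ 1` and `E_{κ q, k} ⊗ b`, and `κ q < q`. -/
theorem map_matUnit_comp_row_mem (hM : IsNilModule x y o) (hD : IsRowData x y o a fn p κ r)
    (hx : x.rTensor _ ∈ B) (hy : y.rTensor _ ∈ B)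
    (hc : rowOp (row o p κ r) (Finsupp.single o (1 : F)) ∈ B) (q k : ℕ)
    {b : Module.End F V} (hb : b ∈ Submodule.span F (Set.range a)) :
    TensorProduct.mk F (ℕ →₀ F) _ (Finsupp.single o 1) ∘ₗ TensorProduct.map (matUnit F q k) b ∘ₗ
      TensorProduct.lift (row o p κ r) ∈ B := by
  induction q using Nat.strong_induction_on with
  | _ q ih =>
    by_cases hq : q ∈ fn
    · have h := rowOp_entry_mul_mem hM hx hy hc (ih (κ q) (hD.fn_κ q hq)) (Finsupp.single q 1)
      rw [row_single_of_ne (show q ≠ o from fun h => hD.origin (h ▸ hq)), ← TensorProduct.map_mul,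
        hD.fn_p q hq, hD.fn_r q hq, matUnit_mul_same, one_mul] at h
      exact h
    · clear ih
      induction hb using Submodule.span_induction with
      | mem b h =>
        obtain ⟨t, rfl⟩ := h
        obtain ⟨i, hio, rfl, rfl, hr⟩ := hD.free t q k hq
        have h := rowOp_entry_mem hM hx hy hc (Finsupp.single i 1)
        rw [row_single_of_ne hio, hr] at h
        exact h
      | zero =>
        rw [TensorProduct.map_zero_right, LinearMap.zero_comp, LinearMap.comp_zero]
        exact B.zero_mem
      | add b b' _ _ h h' =>
        rw [TensorProduct.map_add_right, LinearMap.add_comp, LinearMap.comp_add]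
        exact B.add_mem h h'
      | smul c b _ h =>
        rw [TensorProduct.map_smul_right, LinearMap.smul_comp, LinearMap.comp_smul]
        exact B.smul_mem _ h

/-- Multiplication of `E_{q,i} ⊗ b` times the row by `n ⊗ 1` isolates the functional `e_i^* ∘ n`,
for `i ∈ fn`. Linear combinations give all coordinate functionals, hence all matrix units. -/
theorem blockUnit_mem (hM : IsNilModule x y o) (hD : IsRowData x y o a fn p κ r)
    (hx : x.rTensor _ ∈ B) (hy : y.rTensor _ ∈ B)
    (hc : rowOp (row o p κ r) (Finsupp.single o (1 : F)) ∈ B) (i j : ℕ × ℕ)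
    {b : Module.End F V} (hb : b ∈ Submodule.span F (Set.range a)) :
    blockUnit i j b ∈ B := by
  obtain ⟨i, q⟩ := i
  obtain ⟨j, l⟩ := j
  have key : ∀ f : (ℕ →₀ F) →ₗ[F] F, f ∈ Submodule.span F
      {f | ∃ i ∈ fn, κ i = l ∧ ∃ n ∈ NonUnitalAlgebra.adjoin F {x, y},
        f = (Finsupp.lapply i : (ℕ →₀ F) →ₗ[F] F) ∘ₗ n} →
      TensorProduct.map (f.smulRight (Finsupp.single o (1 : F)))
        (TensorProduct.map (matUnit F q l) b) ∈ B := by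
    intro f hf
    induction hf using Submodule.span_induction with
    | mem f h =>
      obtain ⟨i, hi, rfl, n, hn, rfl⟩ := h
      have h := B.mul_mem (map_matUnit_comp_row_mem hM hD hx hy hc q i hb) (rTensor_mem hx hy hn)
      refine (congrArg (· ∈ B) (TensorProduct.ext' fun u v => ?_)).mp h
      have h2 := LinearMap.congr_fun (map_matUnit_mul_row hD hi q b (n u)) v
      rw [hM.coord_origin hn, zero_smul, zero_add] at h2
      simp only [Module.End.mul_apply, LinearMap.rTensor_tmul, LinearMap.comp_apply,
        TensorProduct.lift.tmul] at h2 ⊢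
      rw [h2]
      simp [TensorProduct.smul_tmul']
    | zero =>
      have : (0 : (ℕ →₀ F) →ₗ[F] F).smulRight (Finsupp.single o (1 : F)) = 0 := by ext; simp
      rw [this, TensorProduct.map_zero_left]
      exact B.zero_mem
    | add f f' _ _ h h' =>
      have : (f + f').smulRight (Finsupp.single o (1 : F)) =
        f.smulRight (Finsupp.single o (1 : F)) + f'.smulRight (Finsupp.single o (1 : F)) := by
        refine LinearMap.ext fun u => ?_
        simp [add_smul]
      rw [this, TensorProduct.map_add_left]
      exact B.add_mem h h'
    | smul c f _ h =>
      have : (c • f).smulRight (Finsupp.single o (1 : F)) =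
        c • f.smulRight (Finsupp.single o (1 : F)) := by
        refine LinearMap.ext fun u => ?_
        simp [mul_smul]
      rw [this, TensorProduct.map_smul_left]
      exact B.smul_mem _ h
  have h1 := key _ (hD.coord_mem_span j l)
  -- This is an operator of the form `e_o ⊗ f`, and `e_o` can be replaced by `e_i`.
  let f : (ℕ →₀ F) ⊗[F] ((ℕ →₀ F) ⊗[F] V) →ₗ[F] (ℕ →₀ F) ⊗[F] V :=
    TensorProduct.map (matUnit F q l) b ∘ₗ (TensorProduct.lid F ((ℕ →₀ F) ⊗[F] V)).toLinearMap ∘ₗ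
      (Finsupp.lapply j : (ℕ →₀ F) →ₗ[F] F).rTensor ((ℕ →₀ F) ⊗[F] V)
  have hf : ∀ u : ℕ →₀ F, TensorProduct.map ((Finsupp.lapply j : (ℕ →₀ F) →ₗ[F] F).smulRight u)
      (TensorProduct.map (matUnit F q l) b) = TensorProduct.mk F (ℕ →₀ F) _ u ∘ₗ f := by
    intro u
    refine TensorProduct.ext' fun u' v => ?_
    simp [f, TensorProduct.smul_tmul]
  rw [hf] at h1
  have h2 := mk_comp_mem hM hx hy h1 (Finsupp.single i 1)
  rw [← hf] at h2
  exact h2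

end Generation

/-! ### Finitary matrices as operators -/

section FinitaryRep

variable {F : Type*} [Field F] {V : Type*} [AddCommGroup V] [Module F V]
  {A : Type*} [NonUnitalRing A] [Module F A]

theorem FinitaryMatrix.sum_entries_eq {C : Type*} [AddCommMonoid C] (M : FinitaryMatrix ℕ A)
    (f : ℕ × ℕ → A → C) (hf : ∀ p, f p 0 = 0) (s : Finset ℕ)
    (hs : M.entries.support ⊆ s ×ˢ s) :
    M.entries.sum f = ∑ i ∈ s, ∑ j ∈ s, f (i, j) (M.entries (i, j)) := by
  rw [Finsupp.sum_of_support_subset _ hs _ (fun p _ => hf p), Finset.sum_product]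

/-- The representation of `M_∞(A)` on a direct sum of copies of `V` that are indexed by
`ℕ × ℕ ≃ ℕ`. -/
noncomputable def finitaryRep (ρ : A →ₙₐ[F] Module.End F V) :
    FinitaryMatrix ℕ A →ₙₐ[F] Module.End F ((ℕ →₀ F) ⊗[F] ((ℕ →₀ F) ⊗[F] V)) where
  toFun M := M.entries.sum fun ij a =>
    blockUnit (Nat.pairEquiv.symm ij.1) (Nat.pairEquiv.symm ij.2) (ρ a)
  map_smul' c M := by
    rw [FinitaryMatrix.entries_smul, Finsupp.sum_smul_index' (fun i => by simp), Finsupp.smul_sum]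
    simp
  map_zero' := by simp [FinitaryMatrix.entries_zero]
  map_add' M N := by
    rw [FinitaryMatrix.entries_add]
    exact Finsupp.sum_add_index' (fun i => by simp) (fun i a b => by simp)
  map_mul' M N := by
    classical
    let t := M.entries.support ∪ N.entries.support ∪ (M * N).entries.support
    let s := t.image Prod.fst ∪ t.image Prod.snd
    have hs : ∀ p ∈ t, p ∈ s ×ˢ s := fun p hp => Finset.mem_product.2
      ⟨Finset.mem_union_left _ (Finset.mem_image_of_mem _ hp),
        Finset.mem_union_right _ (Finset.mem_image_of_mem _ hp)⟩
    have hM : M.entries.support ⊆ s ×ˢ s := fun p hp => hs p (by simp only [t]; grind)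
    have hN : N.entries.support ⊆ s ×ˢ s := fun p hp => hs p (by simp only [t]; grind)
    have hMN : (M * N).entries.support ⊆ s ×ˢ s := fun p hp => hs p (by simp only [t]; grind)
    have hM' : M.entries.support.image Prod.snd ⊆ s := fun k hk => by
      obtain ⟨p, hp, rfl⟩ := Finset.mem_image.1 hk
      exact (Finset.mem_product.1 (hM hp)).2
    have hmul : ∀ i j, (M * N).entries (i, j) = ∑ k ∈ s, M.entries (i, k) * N.entries (k, j) :=
      FinitaryMatrix.entries_mul_of_left M N s (by convert hM')
    rw [FinitaryMatrix.sum_entries_eq M _ (by simp) s hM,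
      FinitaryMatrix.sum_entries_eq N _ (by simp) s hN,
      FinitaryMatrix.sum_entries_eq (M * N) _ (by simp) s hMN, Finset.sum_mul]
    refine Finset.sum_congr rfl fun i _ => ?_
    rw [Finset.sum_mul]
    simp only [hmul, map_sum]
    refine Finset.sum_comm.trans (Finset.sum_congr rfl fun k hk => ?_)
    rw [Finset.mul_sum]
    refine Eq.trans ?_ (Finset.sum_eq_single k ?_ ?_).symm
    · rw [Finset.mul_sum]
      refine Finset.sum_congr rfl fun j _ => ?_
      rw [blockUnit_mul_same, map_mul]
    · intro k' _ hk'
      rw [Finset.mul_sum]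
      exact Finset.sum_eq_zero fun j _ => blockUnit_mul_of_ne _ _
        (fun h => hk' (Nat.pairEquiv.symm.injective h).symm) _ _
    · exact fun h => absurd hk h

theorem finitaryRep_apply (ρ : A →ₙₐ[F] Module.End F V) (M : FinitaryMatrix ℕ A) :
    finitaryRep ρ M = M.entries.sum fun ij a =>
      blockUnit (Nat.pairEquiv.symm ij.1) (Nat.pairEquiv.symm ij.2) (ρ a) := rfl

theorem finitaryRep_coord (ρ : A →ₙₐ[F] Module.End F V) (M : FinitaryMatrix ℕ A) (i j : ℕ) (v : V) :
    blockCoord (Nat.pairEquiv.symm i)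
      (finitaryRep ρ M (blockSingle (Nat.pairEquiv.symm j) v)) = ρ (M.entries (i, j)) v := by
  classical
  rw [finitaryRep_apply, Finsupp.sum, LinearMap.sum_apply, map_sum, Finset.sum_eq_single (i, j)]
  · rw [blockUnit_apply_apply, blockCoord_blockSingle_same, blockCoord_blockSingle_same]
  · rintro ⟨i', j'⟩ _ hne
    rw [blockUnit_apply_apply]
    by_cases hi : i' = i
    · have hj : j ≠ j' := fun hj => hne (by rw [hi, hj])
      rw [blockCoord_blockSingle_of_ne (fun h => hj (Nat.pairEquiv.symm.injective h))]
      simp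
    · rw [blockCoord_blockSingle_of_ne (fun h => hi (Nat.pairEquiv.symm.injective h))]
  · intro h
    rw [Finsupp.notMem_support_iff.1 h]
    simp

theorem finitaryRep_injective {ρ : A →ₙₐ[F] Module.End F V} (hρ : Function.Injective ρ) :
    Function.Injective (finitaryRep ρ) := by
  intro M N h
  ext ⟨i, j⟩
  refine hρ (LinearMap.ext fun v => ?_)
  rw [← finitaryRep_coord, ← finitaryRep_coord, h]

theorem blockUnit_mem_range_finitaryRep (ρ : A →ₙₐ[F] Module.End F V) (p q : ℕ × ℕ) (a : A) :
    blockUnit p q (ρ a) ∈ NonUnitalAlgHom.range (finitaryRep ρ) := by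
  refine ⟨⟨Finsupp.single (Nat.pairEquiv p, Nat.pairEquiv q) a⟩, ?_⟩
  change finitaryRep ρ _ = _
  rw [finitaryRep_apply, Finsupp.sum_single_index (by simp), Equiv.symm_apply_apply,
    Equiv.symm_apply_apply]

theorem map_smulRight_mem_range_finitaryRep (ρ : A →ₙₐ[F] Module.End F V) (u : ℕ →₀ F)
    (j k l : ℕ) (a : A) :
    TensorProduct.map ((Finsupp.lapply j : (ℕ →₀ F) →ₗ[F] F).smulRight u)
      (TensorProduct.map (matUnit F k l) (ρ a)) ∈ NonUnitalAlgHom.range (finitaryRep ρ) := by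
  induction u using Finsupp.induction_linear with
  | zero =>
    have : (Finsupp.lapply j : (ℕ →₀ F) →ₗ[F] F).smulRight (0 : ℕ →₀ F) = 0 := by
      refine LinearMap.ext fun w => ?_
      simp
    rw [this, TensorProduct.map_zero_left]
    exact zero_mem _
  | add u u' hu hu' =>
    have : (Finsupp.lapply j : (ℕ →₀ F) →ₗ[F] F).smulRight (u + u') =
        (Finsupp.lapply j : (ℕ →₀ F) →ₗ[F] F).smulRight u +
          (Finsupp.lapply j : (ℕ →₀ F) →ₗ[F] F).smulRight u' := by
      refine LinearMap.ext fun w => ?_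
      simp
    rw [this, TensorProduct.map_add_left]
    exact add_mem hu hu'
  | single i c =>
    have : (Finsupp.lapply j : (ℕ →₀ F) →ₗ[F] F).smulRight (Finsupp.single i c) =
        c • matUnit F i j := by
      refine LinearMap.ext fun w => ?_
      simp [matUnit_apply, mul_comm]
    rw [this, TensorProduct.map_smul_left]
    exact SMulMemClass.smul_mem _ (blockUnit_mem_range_finitaryRep ρ (i, k) (j, l) a)

theorem mul_mem_range_finitaryRep_of_blockUnit {ρ : A →ₙₐ[F] Module.End F V}
    {T : Module.End F ((ℕ →₀ F) ⊗[F] ((ℕ →₀ F) ⊗[F] V))}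
    (hT : ∀ p q a, T * blockUnit p q (ρ a) ∈ NonUnitalAlgHom.range (finitaryRep ρ))
    (M : FinitaryMatrix ℕ A) : T * finitaryRep ρ M ∈ NonUnitalAlgHom.range (finitaryRep ρ) := by
  rw [finitaryRep_apply, Finsupp.sum, Finset.mul_sum]
  exact sum_mem fun _ _ => hT _ _ _

/-- Multiplication by `n ⊗ 1` mixes the rows of a finitary matrix with coefficients in `F`. -/
theorem rTensor_mul_mem_range_finitaryRep (ρ : A →ₙₐ[F] Module.End F V)
    (n : Module.End F (ℕ →₀ F)) (M : FinitaryMatrix ℕ A) :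
    n.rTensor ((ℕ →₀ F) ⊗[F] V) * finitaryRep ρ M ∈ NonUnitalAlgHom.range (finitaryRep ρ) := by
  refine mul_mem_range_finitaryRep_of_blockUnit (fun p q a => ?_) M
  have : n.rTensor ((ℕ →₀ F) ⊗[F] V) * blockUnit p q (ρ a) =
      TensorProduct.map ((Finsupp.lapply q.1 : (ℕ →₀ F) →ₗ[F] F).smulRight
        (n (Finsupp.single p.1 1))) (TensorProduct.map (matUnit F p.2 q.2) (ρ a)) := by
    refine TensorProduct.ext' fun u v => ?_
    simp only [Module.End.mul_apply, blockUnit_apply, TensorProduct.map_tmul,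
      LinearMap.rTensor_tmul, matUnit_apply, map_smul, LinearMap.smulRight_apply,
      Finsupp.lapply_apply]
  rw [this]
  exact map_smulRight_mem_range_finitaryRep _ _ _ _ _ _

/-- A finitary matrix involves only finitely many entries `1` and `E_{p i, κ i} ⊗ r i` of the row,
where `r i` is a scalar or belongs to the image of `A`. -/
theorem rowOp_mul_mem_range_finitaryRep {x y : Module.End F (ℕ →₀ F)} {o : ℕ} {a : ℕ → A}
    {fn : Set ℕ} {p κ : ℕ → ℕ} {r : ℕ → Module.End F V} {ρ : A →ₙₐ[F] Module.End F V}
    (hD : IsRowData x y o (fun t => ρ (a t)) fn p κ r) (M : FinitaryMatrix ℕ A) :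
    rowOp (row o p κ r) (Finsupp.single o (1 : F)) * finitaryRep ρ M ∈
      NonUnitalAlgHom.range (finitaryRep ρ) := by
  refine mul_mem_range_finitaryRep_of_blockUnit (fun i j b => ?_) M
  have h1 : rowOp (row o p κ r) (Finsupp.single o (1 : F)) * blockUnit i j (ρ b) =
      TensorProduct.map ((Finsupp.lapply j.1 : (ℕ →₀ F) →ₗ[F] F).smulRight
        (Finsupp.single o (1 : F))) (row o p κ r (Finsupp.single i.1 1) *
          TensorProduct.map (matUnit F i.2 j.2) (ρ b)) := by
    refine TensorProduct.ext' fun u v => ?_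
    simp only [Module.End.mul_apply, blockUnit_apply, TensorProduct.map_tmul,
      matUnit_apply, map_smul, LinearMap.smulRight_apply, rowOp, LinearMap.comp_apply,
      TensorProduct.lift.tmul, LinearMap.smul_apply, TensorProduct.mk_apply,
      Finsupp.lapply_apply, TensorProduct.smul_tmul']
  rw [h1]
  by_cases hi : i.1 = o
  · rw [hi, row_single_origin, one_mul]
    exact map_smulRight_mem_range_finitaryRep _ _ _ _ _ _
  · rw [row_single_of_ne hi, ← TensorProduct.map_mul]
    by_cases hκ : κ i.1 = i.2
    · obtain ⟨c, hc⟩ : ∃ c, r i.1 * ρ b = ρ c := by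
        rcases hD.r_mem i.1 with h | h | ⟨t, h⟩ <;> rw [h]
        · exact ⟨0, by simp⟩
        · exact ⟨b, by simp⟩
        · exact ⟨a t * b, by simp⟩
      rw [hκ, matUnit_mul_same, hc]
      exact map_smulRight_mem_range_finitaryRep _ _ _ _ _ _
    · rw [matUnit_mul_of_ne _ _ hκ, TensorProduct.map_zero_left, TensorProduct.map_zero_right]
      exact zero_mem _

end FinitaryRep

section Primitive

variable {F : Type u} [Field F] {V : Type v} [AddCommGroup V] [Module F V]
  {A : Type*} [NonUnitalRing A] [Module F A]

/-- A direct sum of copies of an irreducible `A`-module is irreducible under any set of operators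
that contains all matrix units with coefficients in `A`. -/
theorem eq_bot_or_eq_top_of_blockUnit {ρ : A →ₙₐ[F] Module.End F V} (hρ : IsIrreducibleModule ρ)
    (N : Submodule F ((ℕ →₀ F) ⊗[F] ((ℕ →₀ F) ⊗[F] V)))
    (hN : ∀ p q a, ∀ z ∈ N, blockUnit p q (ρ a) z ∈ N) : N = ⊥ ∨ N = ⊤ := by
  have hann : ∀ v, (∀ a, ρ a v = 0) → v = 0 := by
    let N : Submodule F V :=
      { carrier := {v | ∀ a, ρ a v = 0}
        add_mem' := fun h h' a => by rw [map_add, h, h', add_zero]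
        zero_mem' := fun a => map_zero _
        smul_mem' := fun c v h a => by rw [map_smul, h, smul_zero] }
    have hN : N = ⊥ := by
      refine (hρ.eq_bot_or_eq_top N fun a m hm b => ?_).resolve_right fun h => ?_
      · rw [hm a, map_zero]
      · obtain ⟨a, m, ham⟩ := hρ.exists_ne_zero
        have : m ∈ N := h ▸ Submodule.mem_top
        exact ham (this a)
    intro v hv
    have : v ∈ N := hv
    rw [hN] at this
    exact (Submodule.mem_bot F).1 this
  by_cases hbot : N = ⊥
  · exact Or.inl hbot
  right
  obtain ⟨z, hz, hz0⟩ := Submodule.exists_mem_ne_zero_of_ne_bot hbot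
  obtain ⟨q, hq⟩ := exists_blockCoord_ne_zero hz0
  have hmem : ∀ p q a, ∀ z ∈ N, blockSingle p (ρ a (blockCoord q z)) ∈ N := by
    intro p q a z hz
    rw [← blockUnit_apply_apply]
    exact hN p q a z hz
  let W : Submodule F V := ⨅ p, N.comap (blockSingle p)
  have hW : W = ⊤ := by
    refine (hρ.eq_bot_or_eq_top W fun a m hm => ?_).resolve_left fun h => ?_
    · rw [Submodule.mem_iInf] at hm ⊢
      intro p
      have := hmem p p a _ (hm p)
      rwa [blockCoord_blockSingle_same] at this
    · refine hq (hann _ fun a => ?_)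
      have : ρ a (blockCoord q z) ∈ W := by
        rw [Submodule.mem_iInf]
        exact fun p => hmem p q a z hz
      rwa [h, Submodule.mem_bot] at this
  refine span_blockSingle N fun p v => ?_
  have : v ∈ W := hW ▸ Submodule.mem_top
  exact (Submodule.mem_iInf _).1 this p

theorem exists_blockUnit_apply_ne_zero {ρ : A →ₙₐ[F] Module.End F V} (hρ : IsIrreducibleModule ρ) :
    ∃ a z, blockUnit (F := F) 0 0 (ρ a) z ≠ 0 := by
  obtain ⟨a, m, ham⟩ := hρ.exists_ne_zero
  refine ⟨a, blockSingle 0 m, fun h => ham ?_⟩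
  rw [blockUnit_apply_apply, blockCoord_blockSingle_same] at h
  rw [← blockCoord_blockSingle_same (F := F) 0 (ρ a m), h, map_zero]

end Primitive

section Embedding

theorem isAlgebraicAlgebra_of_subalgebra {F C : Type*} [Field F] [Ring C] [Algebra F C]
    (B : NonUnitalSubalgebra F C) (h : ∀ b ∈ B, IsAlgebraic F b) : IsAlgebraicAlgebra F B := by
  intro b
  obtain ⟨p, hp0, hp⟩ := h b b.2
  refine ⟨Polynomial.X * p, mul_ne_zero Polynomial.X_ne_zero hp0, ?_⟩
  let φ : Unitization F B →ₐ[F] C := Unitization.lift (NonUnitalSubalgebraClass.subtype B)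
  have hφ : φ (Polynomial.aeval (Unitization.inr b) (Polynomial.X * p)) = 0 := by
    rw [← Polynomial.aeval_algHom_apply]
    have : φ (Unitization.inr b) = b := by simp [φ]
    rw [this, map_mul, hp, mul_zero]
  obtain ⟨b', hb'⟩ : ∃ b' : B, Polynomial.aeval (Unitization.inr b : Unitization F B)
      (Polynomial.X * p) = Unitization.inr b' := ⟨_, Unitization.ext (by simp) rfl⟩
  rw [hb'] at hφ ⊢
  have : (b' : C) = 0 := by simpa [φ] using hφ
  rw [ZeroMemClass.coe_eq_zero.1 this, Unitization.inr_zero]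

theorem isTwoGenerated_adjoin_pair {F C : Type*} [Field F] [Ring C] [Algebra F C] (x y : C) :
    IsTwoGenerated F (NonUnitalAlgebra.adjoin F {x, y}) := by
  have hx : x ∈ NonUnitalAlgebra.adjoin F {x, y} := NonUnitalAlgebra.subset_adjoin F (by simp)
  have hy : y ∈ NonUnitalAlgebra.adjoin F {x, y} := NonUnitalAlgebra.subset_adjoin F (by simp)
  refine ⟨⟨x, hx⟩, ⟨y, hy⟩, ?_⟩
  rw [eq_top_iff]
  rintro ⟨b, hb⟩ -
  induction hb using NonUnitalAlgebra.adjoin_induction with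
  | mem b h =>
    rcases h with rfl | rfl
    · exact NonUnitalAlgebra.subset_adjoin F (by simp)
    · exact NonUnitalAlgebra.subset_adjoin F (by simp)
  | add b b' _ _ h h' => exact add_mem h h'
  | zero => exact zero_mem _
  | mul b b' _ _ h h' => exact mul_mem h h'
  | smul c b _ h => exact SMulMemClass.smul_mem c h

theorem exists_span_range_eq_top {F A : Type*} [Field F] [AddCommGroup A] [Module F A]
    (h : Module.rank F A ≤ Cardinal.aleph0) :
    ∃ a : ℕ → A, Submodule.span F (Set.range a) = ⊤ := by
  let b := Module.Free.chooseBasis F A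
  have hc : Countable (Module.Free.ChooseBasisIndex F A) := by
    rw [← Cardinal.mk_le_aleph0_iff, b.mk_eq_rank'']
    exact h
  have hs : (insert 0 (Set.range b)).Countable := (Set.countable_range b).insert 0
  obtain ⟨a, ha⟩ := hs.exists_eq_range (Set.insert_nonempty _ _)
  refine ⟨a, ?_⟩
  rw [← ha, eq_top_iff, ← b.span_eq]
  exact Submodule.span_mono (Set.subset_insert _ _)

variable (F : Type u) [Field F] (A : Type v) [NonUnitalRing A] [Module F A]

/-- An algebra of operators on `Z` with two generators satisfies the conclusion of the embedding
theorem as soon as the listed conditions hold; `Z` serves as the faithful irreducible module.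
Algebraicity is written out because `Z` is only assumed to be an additive monoid, so that the
theorem applies to tensor products with `F^(ℕ)`. -/
theorem exists_algebra_of_operators {Z : Type max u v} [i : AddCommMonoid Z] [Module F Z]
    (x g : Module.End F Z) (φ : FinitaryMatrix ℕ A →ₙₐ[F] Module.End F Z)
    (hφ : Function.Injective φ) (hmem : ∀ M, φ M ∈ NonUnitalAlgebra.adjoin F {x, g})
    (hx : ∀ M, x * φ M ∈ NonUnitalAlgHom.range φ) (hg : ∀ M, g * φ M ∈ NonUnitalAlgHom.range φ)
    (halg : ∀ b ∈ NonUnitalAlgebra.adjoin F {x, g}, ∃ p : Polynomial F, p ≠ 0 ∧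
      Polynomial.aeval b p = 0)
    (hne : ∃ b ∈ NonUnitalAlgebra.adjoin F {x, g}, ∃ z, b z ≠ 0)
    (hirr : ∀ N : Submodule F Z,
      (∀ b ∈ NonUnitalAlgebra.adjoin F {x, g}, ∀ z ∈ N, b z ∈ N) → N = ⊥ ∨ N = ⊤) :
    ∃ (B : Type (max u v)) (_ : NonUnitalRing B) (_ : Module F B) (_ : IsScalarTower F B B)
      (_ : SMulCommClass F B B),
      IsTwoGenerated F B ∧ IsAlgebraicAlgebra F B ∧ IsPrimitiveAlgebra F B ∧
        IsMInftyEmbeddableAsLeftIdeal F A B := by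
  obtain ⟨i', rfl⟩ : ∃ i' : AddCommGroup Z, i = i'.toAddCommMonoid :=
    ⟨Module.addCommMonoidToAddCommGroup F, rfl⟩
  refine ⟨NonUnitalAlgebra.adjoin F {x, g}, inferInstance, inferInstance, inferInstance,
    inferInstance, isTwoGenerated_adjoin_pair _ _, isAlgebraicAlgebra_of_subalgebra _ halg,
    ⟨Z, _, _, NonUnitalSubalgebraClass.subtype _, Subtype.val_injective, ⟨?_, ?_⟩⟩,
    NonUnitalAlgHom.codRestrict φ _ hmem, ?_, ?_⟩
  · obtain ⟨b, hb, z, hz⟩ := hne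
    exact ⟨⟨b, hb⟩, z, hz⟩
  · exact fun N hN => hirr N fun b hb => hN ⟨b, hb⟩
  · exact fun M N h => hφ (congrArg Subtype.val h)
  · suffices H : ∀ b ∈ NonUnitalAlgebra.adjoin F {x, g}, ∀ M,
        b * φ M ∈ NonUnitalAlgHom.range φ by
      rintro ⟨b, hb⟩ M
      obtain ⟨M', hM'⟩ := H b hb M
      exact ⟨M', Subtype.ext hM'⟩
    intro b hb
    induction hb using NonUnitalAlgebra.adjoin_induction with
    | mem b h =>
      rcases h with rfl | rfl
      · exact hx
      · exact hg
    | add b b' _ _ h h' => intro M; rw [add_mul]; exact add_mem (h M) (h' M)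
    | zero => intro M; rw [zero_mul]; exact zero_mem _
    | mul b b' _ _ h h' =>
      intro M
      obtain ⟨M', hM'⟩ := h' M
      have hM'' : φ M' = b' * φ M := hM'
      rw [mul_assoc, ← hM'']
      exact h M'
    | smul c b _ h => intro M; rw [smul_mul_assoc]; exact SMulMemClass.smul_mem c (h M)

section Adjoin

variable {F} {U W : Type*} [AddCommGroup U] [Module F U] [AddCommGroup W] [Module F W]
  {x y : Module.End F U} {γ : U →ₗ[F] Module.End F W} {w : U}

/-- If `y ^ k = 0` then `(y ⊗ 1 + c) ^ k = c` for the row operator `c`, so that both summands of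
the second generator belong to the algebra. -/
theorem rowOp_mem_adjoin (hw : γ w = 1) (hyw : y w = 0) (hy : ∀ u, γ (y u) = 0)
    (hnil : IsNilpotent y) :
    rowOp γ w ∈ NonUnitalAlgebra.adjoin F {x.rTensor W, y.rTensor W + rowOp γ w} := by
  obtain ⟨k, hk⟩ := hnil
  have h1 := pow_rTensor_add_rowOp hw hyw hy k
  rw [pow_succ y, hk, zero_mul, LinearMap.rTensor_zero, zero_add] at h1
  have hg : y.rTensor W + rowOp γ w ∈
      NonUnitalAlgebra.adjoin F {x.rTensor W, y.rTensor W + rowOp γ w} :=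
    NonUnitalAlgebra.subset_adjoin F (by simp)
  have hpow : (y.rTensor W + rowOp γ w) ^ (k + 1) ∈
      NonUnitalAlgebra.adjoin F {x.rTensor W, y.rTensor W + rowOp γ w} := by
    clear h1 hk
    induction k with
    | zero => simpa using hg
    | succ k ih => rw [pow_succ]; exact mul_mem ih hg
  rwa [h1] at hpow

theorem rTensor_mem_adjoin (hw : γ w = 1) (hyw : y w = 0) (hy : ∀ u, γ (y u) = 0)
    (hnil : IsNilpotent y) :
    y.rTensor W ∈ NonUnitalAlgebra.adjoin F {x.rTensor W, y.rTensor W + rowOp γ w} := by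
  have hg : y.rTensor W + rowOp γ w ∈
      NonUnitalAlgebra.adjoin F {x.rTensor W, y.rTensor W + rowOp γ w} :=
    NonUnitalAlgebra.subset_adjoin F (by simp)
  simpa using sub_mem hg (rowOp_mem_adjoin (x := x) hw hyw hy hnil)

/-- The generated algebra lies in the wreath product of the nil algebra and `S`. -/
theorem isAlgebraic_of_mem_adjoin
    (hnil : ∀ n ∈ NonUnitalAlgebra.adjoin F {x, y}, IsNilpotent n)
    {S : NonUnitalSubalgebra F (Module.End F W)} (hS : StablyAlgebraic S) (hγ : ∀ u, γ u ∈ S) :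
    ∀ b ∈ NonUnitalAlgebra.adjoin F {x.rTensor W, y.rTensor W + rowOp γ w}, IsAlgebraic F b := by
  have hle : NonUnitalAlgebra.adjoin F {x.rTensor W, y.rTensor W + rowOp γ w} ≤
      wreathProduct (NonUnitalAlgebra.adjoin F {x, y}) S := by
    refine NonUnitalAlgebra.adjoin_le ?_
    rintro _ (rfl | rfl)
    · exact ⟨x, NonUnitalAlgebra.subset_adjoin F (by simp), by simp⟩
    · refine ⟨y, NonUnitalAlgebra.subset_adjoin F (by simp), ?_⟩
      rw [add_sub_cancel_left]
      refine comp_mem_rankIdeal _ fun u => ?_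
      have : TensorProduct.lift γ ∘ₗ TensorProduct.mk F U W u = γ u := by
        ext1 v; simp
      rw [this]
      exact hγ u
  intro b hb
  refine isAlgebraic_of_mem_wreathProduct (fun n hn => ?_) hS (hle hb)
  obtain ⟨k, hk⟩ := hnil n hn
  exact ⟨Polynomial.X ^ k, pow_ne_zero _ Polynomial.X_ne_zero, by simpa using hk⟩

end Adjoin

end Embedding

/-! ### The free algebra on two generators -/

section FreeAlgebra

/-- The free algebra on two generators, as the algebra of the monoid of words in two letters. -/
abbrev WordAlgebra (F : Type u) [Field F] : Type u := MonoidAlgebra F (FreeMonoid Bool)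

variable (F : Type u) [Field F]

/-- The inclusion of the monoid of words into the free algebra. -/
noncomputable def word : FreeMonoid Bool →* WordAlgebra F := MonoidAlgebra.of F _

/-- The basis of the free algebra that consists of the words. -/
noncomputable def wordBasis : Module.Basis (FreeMonoid Bool) F (WordAlgebra F) :=
  Module.Basis.ofRepr (MonoidAlgebra.coeffLinearEquiv F)

theorem wordBasis_apply (w : FreeMonoid Bool) : wordBasis F w = word F w := rfl

theorem span_range_word : Submodule.span F (Set.range (word F)) = ⊤ :=
  (wordBasis F).span_eq

/-- The space of homogeneous elements of degree `n` of the free algebra. -/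
noncomputable def homog (n : ℕ) : Submodule F (WordAlgebra F) :=
  Submodule.span F (word F '' {w | w.length = n})

/-- The projection of the free algebra to its homogeneous component of degree `n`. -/
noncomputable def homogProj (n : ℕ) : WordAlgebra F →ₗ[F] WordAlgebra F :=
  (wordBasis F).constr F fun w => if w.length = n then word F w else 0

variable {F}

theorem word_mem_homog (w : FreeMonoid Bool) : word F w ∈ homog F w.length :=
  Submodule.subset_span ⟨w, rfl, rfl⟩

theorem homogProj_word (n : ℕ) (w : FreeMonoid Bool) :
    homogProj F n (word F w) = if w.length = n then word F w else 0 := by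
  rw [homogProj, ← wordBasis_apply, Module.Basis.constr_basis, wordBasis_apply]

@[elab_as_elim]
theorem word_induction {p : WordAlgebra F → Prop} (f : WordAlgebra F) (hw : ∀ w, p (word F w))
    (h0 : p 0) (hadd : ∀ f g, p f → p g → p (f + g)) (hsmul : ∀ (c : F) f, p f → p (c • f)) :
    p f := by
  have hf : f ∈ Submodule.span F (Set.range (word F)) := by
    rw [span_range_word]; trivial
  induction hf using Submodule.span_induction with
  | mem _ h => obtain ⟨w, rfl⟩ := h; exact hw w
  | zero => exact h0
  | add f g _ _ hf hg => exact hadd f g hf hg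
  | smul c f _ hf => exact hsmul c f hf

theorem homogProj_mem_homog (n : ℕ) (f : WordAlgebra F) : homogProj F n f ∈ homog F n := by
  induction f using word_induction with
  | hw w =>
    rw [homogProj_word]
    split_ifs with h
    · exact h ▸ word_mem_homog w
    · exact zero_mem _
  | h0 => rw [map_zero]; exact zero_mem _
  | hadd f g hf hg => rw [map_add]; exact add_mem hf hg
  | hsmul c f hf => rw [map_smul]; exact Submodule.smul_mem _ _ hf

theorem homogProj_of_mem_homog {d : ℕ} (n : ℕ) {f : WordAlgebra F} (hf : f ∈ homog F d) :
    homogProj F n f = if d = n then f else 0 := by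
  induction hf using Submodule.span_induction with
  | mem _ h => obtain ⟨w, rfl, rfl⟩ := h; exact homogProj_word n w
  | zero => simp
  | add f g _ _ hf hg => rw [map_add, hf, hg]; split_ifs <;> simp
  | smul c f _ hf => rw [map_smul, hf]; split_ifs <;> simp

theorem homogProj_eq_self {d : ℕ} {f : WordAlgebra F} (hf : f ∈ homog F d) :
    homogProj F d f = f := by
  rw [homogProj_of_mem_homog d hf, if_pos rfl]

theorem exists_sum_homogProj (f : WordAlgebra F) :
    ∃ N, ∀ n ≥ N, f = ∑ d ∈ Finset.range n, homogProj F d f := by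
  induction f using word_induction with
  | hw w =>
    refine ⟨w.length + 1, fun n hn => ?_⟩
    simp only [homogProj_word]
    rw [Finset.sum_ite_eq, if_pos (Finset.mem_range.2 hn)]
  | h0 => exact ⟨0, fun n _ => by simp⟩
  | hadd f g hf hg =>
    obtain ⟨N, hN⟩ := hf
    obtain ⟨M, hM⟩ := hg
    refine ⟨max N M, fun n hn => ?_⟩
    simp only [map_add, Finset.sum_add_distrib]
    rw [← hN n (le_trans (le_max_left _ _) hn), ← hM n (le_trans (le_max_right _ _) hn)]
  | hsmul c f hf =>
    obtain ⟨N, hN⟩ := hf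
    refine ⟨N, fun n hn => ?_⟩
    simp only [map_smul, ← Finset.smul_sum]
    rw [← hN n hn]

theorem homog_mul_homog (a b : ℕ) : homog F a * homog F b = homog F (a + b) := by
  rw [homog, homog, homog, Submodule.span_mul_span]
  congr 1
  ext f
  rw [Set.mem_mul]
  constructor
  · rintro ⟨_, ⟨w, rfl, rfl⟩, _, ⟨w', rfl, rfl⟩, rfl⟩
    exact ⟨w * w', FreeMonoid.length_mul _ _, map_mul _ _ _⟩
  · rintro ⟨w, hw, rfl⟩
    refine ⟨_, ⟨FreeMonoid.ofList (w.toList.take a), ?_, rfl⟩, _,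
      ⟨FreeMonoid.ofList (w.toList.drop a), ?_, rfl⟩, ?_⟩
    · have : w.toList.length = a + b := hw
      simp [FreeMonoid.length, this]
    · have : w.toList.length = a + b := hw
      simp [FreeMonoid.length, this]
    · rw [← map_mul, ← FreeMonoid.ofList_append, List.take_append_drop, FreeMonoid.ofList_toList]

theorem mul_mem_homog {a b : ℕ} {f g : WordAlgebra F} (hf : f ∈ homog F a) (hg : g ∈ homog F b) :
    f * g ∈ homog F (a + b) :=
  homog_mul_homog (F := F) a b ▸ Submodule.mul_mem_mul hf hg

theorem one_mem_homog : (1 : WordAlgebra F) ∈ homog F 0 := by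
  have h := word_mem_homog (F := F) 1
  rwa [map_one] at h

theorem homog_eq_span_range (n : ℕ) :
    homog F n = Submodule.span F (Set.range fun w : List.Vector Bool n =>
      word F (FreeMonoid.ofList w.1)) := by
  rw [homog]
  congr 1
  ext f
  constructor
  · rintro ⟨w, hw, rfl⟩
    exact ⟨⟨w.toList, hw⟩, rfl⟩
  · rintro ⟨w, rfl⟩
    exact ⟨_, w.2, rfl⟩

instance (n : ℕ) : FiniteDimensional F (homog F n) := by
  rw [homog_eq_span_range]
  exact FiniteDimensional.span_of_finite F (Set.finite_range _)

theorem homog_fg (n : ℕ) : (homog F n).FG :=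
  (Submodule.fg_iff_finiteDimensional _).2 inferInstance

theorem finrank_homog (n : ℕ) : Module.finrank F (homog F n) = 2 ^ n := by
  rw [homog_eq_span_range, finrank_span_eq_card, card_vector, Fintype.card_bool]
  refine ((wordBasis F).linearIndependent.comp
    (fun w : List.Vector Bool n => FreeMonoid.ofList w.1) ?_)
  intro w w' h
  exact Subtype.ext (FreeMonoid.ofList.injective h)

/-- A graded two-sided ideal of the free algebra. -/
structure IsGradedIdeal (P : Submodule F (WordAlgebra F)) : Prop where
  mul_left : ∀ f, ∀ g ∈ P, f * g ∈ P
  mul_right : ∀ f, ∀ g ∈ P, g * f ∈ P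
  homogProj_mem : ∀ n, ∀ f ∈ P, homogProj F n f ∈ P

end FreeAlgebra

/-! ### The theorem of Golod and Shafarevich -/

section GolodShafarevich

variable {F : Type u} [Field F] {ι : Type*}

/-- The growth argument of Golod and Shafarevich: a sequence with
`a (n + 1) ≥ 2 a n - ∑ i, a (n + 1 - δ i)` stays positive if `∑ i, (2 / 3) ^ δ i ≤ 1 / 3`. -/
theorem golodShafarevich_growth (δ : ι → ℕ) (hδ : ∀ i, 1 ≤ δ i)
    (hsum : ∀ s : Finset ι, ∑ i ∈ s, (2 / 3 : ℝ) ^ δ i ≤ 1 / 3) (a : ℕ → ℝ) (h0 : 0 < a 0)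
    (ha : ∀ n, ∃ s : Finset ι, (∀ i ∈ s, δ i ≤ n + 1) ∧
      2 * a n - ∑ i ∈ s, a (n + 1 - δ i) ≤ a (n + 1)) (n : ℕ) : 0 < a n := by
  -- The invariant: `a` has grown by the factor `3 / 2` in each step so far.
  have key : ∀ n, 0 < a n ∧ ∀ d ≤ n, a (n - d) ≤ (2 / 3 : ℝ) ^ d * a n := by
    intro n
    induction n with
    | zero => exact ⟨h0, fun d hd => by simp [Nat.le_zero.1 hd]⟩
    | succ n ih =>
      obtain ⟨hpos, hle⟩ := ih
      obtain ⟨s, hs, hsa⟩ := ha n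
      have h1 : ∑ i ∈ s, a (n + 1 - δ i) ≤ ∑ i ∈ s, (2 / 3 : ℝ) ^ δ i * (3 / 2 * a n) := by
        refine Finset.sum_le_sum fun i hi => ?_
        have h2 := hle (δ i - 1) (by have := hs i hi; omega)
        have h3 : n - (δ i - 1) = n + 1 - δ i := by have := hδ i; omega
        rw [h3] at h2
        refine h2.trans (le_of_eq ?_)
        obtain ⟨k, hk⟩ := Nat.exists_eq_add_of_le (hδ i)
        rw [hk, Nat.add_sub_cancel_left, pow_add]
        ring
      rw [← Finset.sum_mul] at h1
      have h4 := mul_le_mul_of_nonneg_right (hsum s) (by positivity : (0 : ℝ) ≤ 3 / 2 * a n)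
      have h5 : 3 / 2 * a n ≤ a (n + 1) := by linarith
      refine ⟨by linarith, fun d hd => ?_⟩
      rcases d with _ | d
      · simp
      · have h6 := hle d (by omega)
        rw [Nat.add_sub_add_right, pow_succ]
        have h7 : (0 : ℝ) ≤ (2 / 3 : ℝ) ^ d := by positivity
        nlinarith [mul_le_mul_of_nonneg_left h5 h7]
  exact (key n).1

theorem Submodule.finrank_finset_sup_le {V : Type*} [AddCommGroup V] [Module F V]
    (s : Finset ι) (p : ι → Submodule F V) [∀ i, FiniteDimensional F (p i)] :
    Module.finrank F (s.sup p : Submodule F V) ≤ ∑ i ∈ s, Module.finrank F (p i) := by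
  classical
  induction s using Finset.induction_on with
  | empty => simp
  | insert i s hi ih =>
    rw [Finset.sup_insert, Finset.sum_insert hi]
    have : FiniteDimensional F (s.sup p : Submodule F V) := Submodule.finite_finset_sup s p
    exact (Submodule.finrank_add_le_finrank_add_finrank _ _).trans (by omega)

/-- The ideal of the free algebra that the elements `ρ i` generate. -/
noncomputable def relationIdeal (ρ : ι → WordAlgebra F) : Submodule F (WordAlgebra F) :=
  Submodule.span F {f | ∃ u i v, f = word F u * ρ i * word F v}

/-- The homogeneous component of degree `n` of the ideal generated by elements `ρ i` that are
homogeneous of degree `δ i`. -/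
noncomputable def relationComponent (ρ : ι → WordAlgebra F) (δ : ι → ℕ) (n : ℕ) :
    Submodule F (WordAlgebra F) :=
  Submodule.span F {f | ∃ u i v, u.length + δ i + v.length = n ∧ f = word F u * ρ i * word F v}

variable {ρ : ι → WordAlgebra F} {δ : ι → ℕ}

theorem relationComponent_le_homog (hρ : ∀ i, ρ i ∈ homog F (δ i)) (n : ℕ) :
    relationComponent ρ δ n ≤ homog F n := by
  refine Submodule.span_le.2 ?_
  rintro _ ⟨u, i, v, rfl, rfl⟩
  exact mul_mem_homog (mul_mem_homog (word_mem_homog u) (hρ i)) (word_mem_homog v)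

theorem homogProj_mem_relationComponent (hρ : ∀ i, ρ i ∈ homog F (δ i)) (n : ℕ) {f : WordAlgebra F}
    (hf : f ∈ relationIdeal ρ) : homogProj F n f ∈ relationComponent ρ δ n := by
  induction hf using Submodule.span_induction with
  | mem _ h =>
    obtain ⟨u, i, v, rfl⟩ := h
    rw [homogProj_of_mem_homog n (mul_mem_homog (mul_mem_homog (word_mem_homog u) (hρ i))
      (word_mem_homog v))]
    split_ifs with h
    · exact Submodule.subset_span ⟨u, i, v, h, rfl⟩
    · exact zero_mem _
  | zero => rw [map_zero]; exact zero_mem _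
  | add f g _ _ hf hg => rw [map_add]; exact add_mem hf hg
  | smul c f _ hf => rw [map_smul]; exact Submodule.smul_mem _ _ hf

theorem isGradedIdeal_relationIdeal (hρ : ∀ i, ρ i ∈ homog F (δ i)) :
    IsGradedIdeal (relationIdeal ρ) where
  mul_left f g hg := by
    induction hg using Submodule.span_induction with
    | mem _ h =>
      obtain ⟨u, i, v, rfl⟩ := h
      induction f using word_induction with
      | hw w =>
        refine Submodule.subset_span ⟨w * u, i, v, ?_⟩
        rw [map_mul]; noncomm_ring
      | h0 => rw [zero_mul]; exact zero_mem _
      | hadd f g hf hg => rw [add_mul]; exact add_mem hf hg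
      | hsmul c f hf => rw [smul_mul_assoc]; exact Submodule.smul_mem _ _ hf
    | zero => rw [mul_zero]; exact zero_mem _
    | add f g _ _ hf hg => rw [mul_add]; exact add_mem hf hg
    | smul c f _ hf => rw [mul_smul_comm]; exact Submodule.smul_mem _ _ hf
  mul_right f g hg := by
    induction hg using Submodule.span_induction with
    | mem _ h =>
      obtain ⟨u, i, v, rfl⟩ := h
      induction f using word_induction with
      | hw w =>
        refine Submodule.subset_span ⟨u, i, v * w, ?_⟩
        rw [map_mul]; noncomm_ring
      | h0 => rw [mul_zero]; exact zero_mem _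
      | hadd f g hf hg => rw [mul_add]; exact add_mem hf hg
      | hsmul c f hf => rw [mul_smul_comm]; exact Submodule.smul_mem _ _ hf
    | zero => rw [zero_mul]; exact zero_mem _
    | add f g _ _ hf hg => rw [add_mul]; exact add_mem hf hg
    | smul c f _ hf => rw [smul_mul_assoc]; exact Submodule.smul_mem _ _ hf
  homogProj_mem n f hf := by
    refine Submodule.span_mono ?_ (homogProj_mem_relationComponent hρ n hf)
    rintro _ ⟨u, i, v, -, rfl⟩
    exact ⟨u, i, v, rfl⟩

theorem relation_mem (ρ : ι → WordAlgebra F) (i : ι) : ρ i ∈ relationIdeal ρ :=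
  Submodule.subset_span ⟨1, i, 1, by simp⟩

theorem relationComponent_zero (hδ : ∀ i, 1 ≤ δ i) : relationComponent ρ δ 0 = ⊥ := by
  rw [relationComponent, Submodule.span_eq_bot]
  rintro _ ⟨u, i, v, h, -⟩
  have := hδ i
  omega

theorem relationComponent_mul_word_mem {n : ℕ} (w : FreeMonoid Bool) {f : WordAlgebra F}
    (hf : f ∈ relationComponent ρ δ n) :
    f * word F w ∈ relationComponent ρ δ (n + w.length) := by
  induction hf using Submodule.span_induction with
  | mem _ h =>
    obtain ⟨u, i, v, rfl, rfl⟩ := h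
    refine Submodule.subset_span ⟨u, i, v * w, ?_, ?_⟩
    · rw [FreeMonoid.length_mul]; omega
    · rw [map_mul]; noncomm_ring
  | zero => rw [zero_mul]; exact zero_mem _
  | add f g _ _ hf hg => rw [add_mul]; exact add_mem hf hg
  | smul c f _ hf => rw [smul_mul_assoc]; exact Submodule.smul_mem _ _ hf

/-- A relation `u ρ v` of degree `n + 1` with `v ≠ 1` lies in `I_n x + I_n y`. If `v = 1`, then `u`
can be replaced modulo this space by an element of any complement `C m` of `I_m`. -/
theorem relationComponent_succ_le (hδ : ∀ i, 1 ≤ δ i) (hρ : ∀ i, ρ i ∈ homog F (δ i))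
    (C : ℕ → Submodule F (WordAlgebra F))
    (hC : ∀ m, homog F m ≤ relationComponent ρ δ m ⊔ C m) (n : ℕ) (s : Finset ι)
    (hs : ∀ i, δ i ≤ n + 1 → i ∈ s) :
    relationComponent ρ δ (n + 1) ≤
      ((relationComponent ρ δ n).map (LinearMap.mulRight F (word F (FreeMonoid.of true))) ⊔
        (relationComponent ρ δ n).map (LinearMap.mulRight F (word F (FreeMonoid.of false)))) ⊔
      s.sup fun i => (C (n + 1 - δ i)).map (LinearMap.mulRight F (ρ i)) := by
  have hlast : ∀ (z : Bool) (f : WordAlgebra F), f ∈ relationComponent ρ δ n →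
      f * word F (FreeMonoid.of z) ∈
      ((relationComponent ρ δ n).map (LinearMap.mulRight F (word F (FreeMonoid.of true))) ⊔
        (relationComponent ρ δ n).map (LinearMap.mulRight F (word F (FreeMonoid.of false)))) := by
    intro z f hf
    cases z
    · exact Submodule.mem_sup_right ⟨f, hf, rfl⟩
    · exact Submodule.mem_sup_left ⟨f, hf, rfl⟩
  refine Submodule.span_le.2 ?_
  rintro _ ⟨u, i, v, hn, rfl⟩
  -- Split off the last letter of a word.
  have hsplit : ∀ v : FreeMonoid Bool, v = 1 ∨ ∃ v' z, v = v' * FreeMonoid.of z := by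
    intro v
    rcases List.eq_nil_or_concat v.toList with h | ⟨l, z, h⟩
    · exact Or.inl h
    · exact Or.inr ⟨FreeMonoid.ofList l, z, h.trans (by simp; rfl)⟩
  rcases hsplit v with rfl | ⟨v, z, rfl⟩
  · rw [FreeMonoid.length_one] at hn
    rw [map_one, mul_one]
    have hu : word F u ∈ relationComponent ρ δ (n + 1 - δ i) ⊔ C (n + 1 - δ i) := by
      refine hC _ ?_
      have h := word_mem_homog (F := F) u
      rwa [show u.length = n + 1 - δ i by omega] at h
    obtain ⟨b, hb, c, hc, hbc⟩ := Submodule.mem_sup.1 hu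
    rw [← hbc, add_mul]
    refine add_mem (Submodule.mem_sup_left ?_) (Submodule.mem_sup_right ?_)
    · obtain ⟨m, hm⟩ := Nat.exists_eq_add_of_le (hδ i)
      have hρi : ρ i ∈ homog F m * homog F 1 := by
        rw [homog_mul_homog, show m + 1 = δ i by omega]
        exact hρ i
      generalize ρ i = r at hρi ⊢
      induction hρi using Submodule.mul_induction_on' with
      | mem_mul_mem f hf g hg =>
        induction hg using Submodule.span_induction with
        | mem _ h =>
          obtain ⟨w, hw, rfl⟩ := h
          obtain ⟨z, rfl⟩ := FreeMonoid.length_eq_one.1 hw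
          rw [← mul_assoc]
          refine hlast z _ ?_
          induction hf using Submodule.span_induction with
          | mem _ h =>
            obtain ⟨w, hw, rfl⟩ := h
            have h := relationComponent_mul_word_mem w hb
            rwa [show n + 1 - δ i + w.length = n by
              have : w.length = m := hw
              omega] at h
          | zero => rw [mul_zero]; exact zero_mem _
          | add f g _ _ hf hg => rw [mul_add]; exact add_mem hf hg
          | smul c f _ hf => rw [mul_smul_comm]; exact Submodule.smul_mem _ _ hf
        | zero => rw [mul_zero, mul_zero]; exact zero_mem _
        | add f g _ _ hf hg => rw [mul_add, mul_add]; exact add_mem hf hg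
        | smul c f _ hf => rw [mul_smul_comm, mul_smul_comm]; exact Submodule.smul_mem _ _ hf
      | add f _ g _ hf hg => rw [mul_add]; exact add_mem hf hg
    · exact (Finset.le_sup (f := fun i => (C (n + 1 - δ i)).map (LinearMap.mulRight F (ρ i)))
        (hs i (by omega))) ⟨c, hc, rfl⟩
  · refine Submodule.mem_sup_left ?_
    rw [map_mul, ← mul_assoc]
    refine hlast z _ (Submodule.subset_span ⟨u, i, v, ?_, rfl⟩)
    rw [FreeMonoid.length_mul, FreeMonoid.length_of] at hn
    omega

/-- The theorem of Golod and Shafarevich: relations of degrees `δ i` with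
`∑ i, (2 / 3) ^ δ i ≤ 1 / 3` define an algebra all of whose homogeneous components are nonzero. -/
theorem not_homog_le_relationIdeal (hδ : ∀ i, 1 ≤ δ i) (hρ : ∀ i, ρ i ∈ homog F (δ i))
    (hsum : ∀ s : Finset ι, ∑ i ∈ s, (2 / 3 : ℝ) ^ δ i ≤ 1 / 3) (n : ℕ) :
    ¬ homog F n ≤ relationIdeal ρ := by
  classical
  have hle := relationComponent_le_homog hρ
  have hfin : ∀ m, FiniteDimensional F (relationComponent ρ δ m) := fun m =>
    Submodule.finiteDimensional_of_le (hle m)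
  have hcompl : ∀ m, ∃ C, relationComponent ρ δ m ⊔ C = homog F m ∧
      Disjoint (relationComponent ρ δ m) C := by
    intro m
    obtain ⟨C, hC⟩ := exists_isCompl (relationComponent ρ δ m)
    refine ⟨C ⊓ homog F m, ?_, hC.disjoint.mono_right inf_le_left⟩
    rw [← sup_inf_assoc_of_le _ (hle m), hC.sup_eq_top, top_inf_eq]
  choose C hC hdisj using hcompl
  have hCle : ∀ m, C m ≤ homog F m := fun m => (hC m) ▸ le_sup_right
  have hCfin : ∀ m, FiniteDimensional F (C m) := fun m =>
    Submodule.finiteDimensional_of_le (hCle m)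
  have hdim : ∀ m, Module.finrank F (relationComponent ρ δ m) + Module.finrank F (C m) = 2 ^ m := by
    intro m
    rw [← finrank_homog (F := F), ← hC m, ← Submodule.finrank_sup_add_finrank_inf_eq,
      (hdisj m).eq_bot, finrank_bot, add_zero]
  -- Only finitely many relations have degree at most `m`.
  have hfinite : ∀ m, {i | δ i ≤ m}.Finite := by
    intro m
    by_contra hinf
    obtain ⟨s, hs, hcard⟩ := Set.Infinite.exists_subset_card_eq hinf
      (⌈(1 / 3 : ℝ) / (2 / 3) ^ m⌉₊ + 1)
    have h1 : (s.card : ℝ) * (2 / 3) ^ m ≤ ∑ i ∈ s, (2 / 3 : ℝ) ^ δ i := by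
      rw [← nsmul_eq_mul]
      exact Finset.card_nsmul_le_sum _ _ _ fun i hi =>
        pow_le_pow_of_le_one (by norm_num) (by norm_num) (hs hi)
    have h2 : (s.card : ℝ) ≤ (1 / 3 : ℝ) / (2 / 3) ^ m := by
      rw [le_div_iff₀ (by positivity)]
      exact h1.trans (hsum s)
    rw [hcard] at h2
    push_cast at h2
    linarith [Nat.le_ceil ((1 / 3 : ℝ) / (2 / 3) ^ m)]
  have hpos := golodShafarevich_growth δ hδ hsum (fun m => (Module.finrank F (C m) : ℝ)) ?_ ?_ n
  · intro h
    have h1 : C n = ⊥ := by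
      refine (hdisj n).symm.eq_bot_of_le fun f hf => ?_
      rw [← homogProj_eq_self (hCle n hf)]
      exact homogProj_mem_relationComponent hρ n (h (hCle n hf))
    have h2 : Module.finrank F (C n) = 0 := by rw [h1, finrank_bot]
    simp [h2] at hpos
  · have h := hdim 0
    rw [relationComponent_zero hδ, finrank_bot] at h
    have h' : Module.finrank F (C 0) = 1 := by simpa using h
    simp [h']
  · intro m
    refine ⟨(hfinite (m + 1)).toFinset, fun i hi => (hfinite (m + 1)).mem_toFinset.1 hi, ?_⟩
    set s := (hfinite (m + 1)).toFinset
    have h1 := relationComponent_succ_le hδ hρ C (fun m => (hC m).ge) m s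
      (fun i hi => (hfinite (m + 1)).mem_toFinset.2 hi)
    have hsfin : FiniteDimensional F
        (s.sup fun i => (C (m + 1 - δ i)).map (LinearMap.mulRight F (ρ i)) :
          Submodule F (WordAlgebra F)) := Submodule.finite_finset_sup s _
    have h2 := (Submodule.finrank_mono h1).trans
      ((Submodule.finrank_add_le_finrank_add_finrank _ _).trans
        (add_le_add (Submodule.finrank_add_le_finrank_add_finrank _ _)
          (Submodule.finrank_finset_sup_le s _)))
    have h3 : ∀ z, Module.finrank F ((relationComponent ρ δ m).map
        (LinearMap.mulRight F (word F z))) ≤ Module.finrank F (relationComponent ρ δ m) :=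
      fun z => Submodule.finrank_map_le _ _
    have h4 : ∑ i ∈ s, Module.finrank F ((C (m + 1 - δ i)).map (LinearMap.mulRight F (ρ i))) ≤
        ∑ i ∈ s, Module.finrank F (C (m + 1 - δ i)) :=
      Finset.sum_le_sum fun i _ => Submodule.finrank_map_le _ _
    have h5 : Module.finrank F (relationComponent ρ δ (m + 1)) ≤
        2 * Module.finrank F (relationComponent ρ δ m) +
          ∑ i ∈ s, Module.finrank F (C (m + 1 - δ i)) := by
      have := h3 (FreeMonoid.of true)
      have := h3 (FreeMonoid.of false)
      omega
    have h6 := hdim m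
    have h7 := hdim (m + 1)
    rw [pow_succ] at h7
    have h8 : 2 * Module.finrank F (C m) ≤ Module.finrank F (C (m + 1)) +
        ∑ i ∈ s, Module.finrank F (C (m + 1 - δ i)) := by omega
    have h9 : (2 * Module.finrank F (C m) : ℝ) ≤ Module.finrank F (C (m + 1)) +
        ∑ i ∈ s, (Module.finrank F (C (m + 1 - δ i)) : ℝ) := by exact_mod_cast h8
    linarith

end GolodShafarevich

/-! ### A graded ideal with nil quotient -/

section NilIdeal

open scoped Classical

variable {F : Type u} [Field F]

/-- Finite sets of nonempty words. -/
abbrev WordSet : Type := {L : Finset (FreeMonoid Bool) // 1 ∉ L}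

/-- How often each word of `L` occurs in the sequence `s`. -/
noncomputable def wordCount {L : WordSet} {K : ℕ} (s : Fin K → L.1) (w : L.1) : Fin (K + 1) :=
  ⟨(Finset.univ.filter fun i => s i = w).card,
    Nat.lt_succ_of_le ((Finset.card_le_univ _).trans (Fintype.card_fin K).le)⟩

/-- The concatenation of a sequence of words. -/
def wordConcat {L : WordSet} {K : ℕ} (s : Fin K → L.1) : FreeMonoid Bool :=
  (List.ofFn fun i => (s i : FreeMonoid Bool)).prod

/-- The sum of the concatenations of all sequences in which every `w ∈ L` occurs `μ w` times. This
is the coefficient of `∏ w, c w ^ μ w` in `(∑ w, c w • w) ^ K`. -/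
noncomputable def powerRelation (F : Type u) [Field F] {L : WordSet} {K : ℕ}
    (μ : L.1 → Fin (K + 1)) : WordAlgebra F :=
  ∑ s : Fin K → L.1 with wordCount s = μ, word F (wordConcat s)

theorem length_wordConcat {L : WordSet} {K : ℕ} (s : Fin K → L.1) :
    (wordConcat s).length = ∑ i, (s i : FreeMonoid Bool).length := by
  have h : ∀ l : List (FreeMonoid Bool),
      l.prod.length = (l.map FreeMonoid.length).sum := by
    intro l
    induction l with
    | nil => rfl
    | cons a l ih => rw [List.prod_cons, FreeMonoid.length_mul, ih, List.map_cons, List.sum_cons]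
  rw [wordConcat, h, List.map_ofFn, List.sum_ofFn]
  rfl

theorem length_wordConcat_eq {L : WordSet} {K : ℕ} (s : Fin K → L.1) :
    (wordConcat s).length =
      max K (∑ w, (wordCount s w : ℕ) * (w : FreeMonoid Bool).length) := by
  have h1 : ∑ i, (s i : FreeMonoid Bool).length =
      ∑ w, (wordCount s w : ℕ) * (w : FreeMonoid Bool).length := by
    rw [← Finset.sum_fiberwise (s := Finset.univ) (g := s)]
    refine Finset.sum_congr rfl fun w _ => ?_
    rw [Finset.sum_congr rfl (g := fun _ => (w : FreeMonoid Bool).length)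
      (fun i hi => by rw [(Finset.mem_filter.1 hi).2]), Finset.sum_const, smul_eq_mul]
    rfl
  have h2 : K ≤ ∑ i, (s i : FreeMonoid Bool).length := by
    calc K = ∑ _i : Fin K, 1 := by simp
      _ ≤ _ := Finset.sum_le_sum fun i _ => by
        rw [Nat.one_le_iff_ne_zero, Ne, FreeMonoid.length_eq_zero]
        intro h
        have := (s i).2
        rw [h] at this
        exact L.2 this
  rw [length_wordConcat, ← h1, max_eq_right h2]

theorem powerRelation_mem_homog {L : WordSet} {K : ℕ} (μ : L.1 → Fin (K + 1)) :
    powerRelation F μ ∈ homog F (max K (∑ w, (μ w : ℕ) * (w : FreeMonoid Bool).length)) := by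
  refine sum_mem fun s hs => ?_
  rw [← (Finset.mem_filter.1 hs).2, ← length_wordConcat_eq]
  exact word_mem_homog _

theorem sum_smul_word_pow {L : WordSet} (c : L.1 → F) (K : ℕ) :
    (∑ w, c w • word F w) ^ K =
      ∑ s : Fin K → L.1, (∏ i, c (s i)) • word F (wordConcat s) := by
  induction K with
  | zero => simp [wordConcat]
  | succ K ih =>
    rw [pow_succ', ih, ← (Fin.consEquiv fun _ => L.1).sum_comp, Fintype.sum_prod_type,
      Finset.sum_mul]
    refine Finset.sum_congr rfl fun w _ => ?_
    rw [Finset.mul_sum]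
    refine Finset.sum_congr rfl fun s _ => ?_
    simp [Fin.prod_univ_succ, wordConcat, Fin.consEquiv, List.ofFn_succ, smul_smul, mul_comm]

theorem sum_smul_word_pow_eq {L : WordSet} (c : L.1 → F) (K : ℕ) :
    (∑ w, c w • word F w) ^ K =
      ∑ μ : L.1 → Fin (K + 1), (∏ w, c w ^ (μ w : ℕ)) • powerRelation F μ := by
  rw [sum_smul_word_pow, ← Finset.sum_fiberwise (s := Finset.univ) (g := wordCount)]
  refine Finset.sum_congr rfl fun μ _ => ?_
  rw [powerRelation, Finset.smul_sum]
  refine Finset.sum_congr rfl fun s hs => ?_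
  congr 1
  rw [← (Finset.mem_filter.1 hs).2, ← Finset.prod_fiberwise (s := Finset.univ) (g := s)]
  refine Finset.prod_congr rfl fun w _ => ?_
  rw [Finset.prod_congr rfl (g := fun _ => c w)
    (fun i hi => by rw [(Finset.mem_filter.1 hi).2]), Finset.prod_const]
  rfl

/-- For large `K` the relations that make all linear combinations of `L` nilpotent of order `K` are
sparse, since there are at most `(K + 1) ^ |L|` of them. -/
theorem exists_nil_exponent (L : ℕ) {ε : ℝ} (hε : 0 < ε) :
    ∃ K : ℕ, 1 ≤ K ∧ ((K : ℝ) + 1) ^ L * (2 / 3) ^ K ≤ ε := by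
  have h := tendsto_pow_const_mul_const_pow_of_abs_lt_one L
    (show |(2 / 3 : ℝ)| < 1 by rw [abs_of_pos] <;> norm_num)
  have h' := h.comp (Filter.tendsto_add_atTop_nat 1)
  have hev := (h'.eventually (ge_mem_nhds (show (0 : ℝ) < ε * (2 / 3) by positivity))).and
    (Filter.eventually_ge_atTop 1)
  obtain ⟨K, hK, hK1⟩ := hev.exists
  refine ⟨K, hK1, ?_⟩
  simp only [Function.comp_apply, Nat.cast_add, Nat.cast_one, pow_succ (2 / 3 : ℝ) K] at hK
  nlinarith

theorem exists_nil_gradedIdeal : ∃ P : Submodule F (WordAlgebra F), IsGradedIdeal P ∧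
    (∀ n, ¬ homog F n ≤ P) ∧ ∀ f, homogProj F 0 f = 0 → ∃ k, f ^ k ∈ P := by
  have : Encodable WordSet := Encodable.ofCountable _
  have hK : ∀ L : WordSet, ∃ K : ℕ, 1 ≤ K ∧
      ((K : ℝ) + 1) ^ L.1.card * (2 / 3) ^ K ≤ (1 / 2) ^ Encodable.encode L / 6 := fun L =>
    exists_nil_exponent _ (by positivity)
  choose K hK1 hK using hK
  let ρ : (Σ L : WordSet, L.1 → Fin (K L + 1)) → WordAlgebra F := fun i => powerRelation F i.2
  let δ : (Σ L : WordSet, L.1 → Fin (K L + 1)) → ℕ := fun i =>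
    max (K i.1) (∑ w, (i.2 w : ℕ) * (w : FreeMonoid Bool).length)
  have hρ : ∀ i, ρ i ∈ homog F (δ i) := fun i => powerRelation_mem_homog i.2
  refine ⟨relationIdeal ρ, isGradedIdeal_relationIdeal hρ,
    not_homog_le_relationIdeal (fun i => (hK1 i.1).trans (le_max_left _ _)) hρ ?_, ?_⟩
  · intro s
    have h1 : s ⊆ (s.image Sigma.fst).sigma fun _ => Finset.univ := fun i hi =>
      Finset.mem_sigma.2 ⟨Finset.mem_image_of_mem _ hi, Finset.mem_univ _⟩
    calc ∑ i ∈ s, (2 / 3 : ℝ) ^ δ i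
        ≤ ∑ i ∈ s, (2 / 3 : ℝ) ^ K i.1 := Finset.sum_le_sum fun i _ =>
          pow_le_pow_of_le_one (by norm_num) (by norm_num) (le_max_left _ _)
      _ ≤ ∑ i ∈ (s.image Sigma.fst).sigma fun _ => Finset.univ, (2 / 3 : ℝ) ^ K i.1 :=
          Finset.sum_le_sum_of_subset_of_nonneg h1 fun i _ _ => by positivity
      _ = ∑ L ∈ s.image Sigma.fst, ((K L : ℝ) + 1) ^ L.1.card * (2 / 3) ^ K L := by
          rw [Finset.sum_sigma]
          refine Finset.sum_congr rfl fun L _ => ?_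
          simp
      _ ≤ ∑ L ∈ s.image Sigma.fst, (1 / 2 : ℝ) ^ Encodable.encode L / 6 :=
          Finset.sum_le_sum fun L _ => hK L
      _ = (∑ n ∈ (s.image Sigma.fst).image Encodable.encode, (1 / 2 : ℝ) ^ n) / 6 := by
          rw [Finset.sum_image fun a _ b _ h => Encodable.encode_injective h, Finset.sum_div]
      _ ≤ 2 / 6 := by
          have h := summable_geometric_two.sum_le_tsum
            ((s.image Sigma.fst).image Encodable.encode) fun _ _ => by positivity
          rw [tsum_geometric_two] at h
          gcongr
      _ = 1 / 3 := by norm_num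
  · intro f hf
    let L : WordSet := ⟨f.coeff.support.erase 1, Finset.notMem_erase _ _⟩
    have hf0 : f.coeff 1 = 0 := by
      have h : (homogProj F 0 f).coeff 1 = f.coeff 1 := by
        clear hf L
        induction f using word_induction with
        | hw w =>
          rw [homogProj_word]
          split_ifs with h
          · rfl
          · rw [FreeMonoid.length_eq_zero] at h
            exact (Finsupp.single_eq_of_ne (Ne.symm h)).symm
        | h0 => rw [map_zero]
        | hadd f g hf hg =>
          rw [map_add, MonoidAlgebra.coeff_add, MonoidAlgebra.coeff_add, Finsupp.add_apply,
            Finsupp.add_apply, hf, hg]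
        | hsmul c f hf =>
          rw [map_smul, MonoidAlgebra.coeff_smul_apply, MonoidAlgebra.coeff_smul_apply, hf]
      rw [← h, hf]
      rfl
    have hfL : f = ∑ w : L.1, f.coeff w • word F w := by
      have h : f.coeff.support.erase 1 = f.coeff.support :=
        Finset.erase_eq_of_notMem (by simp [hf0])
      rw [Finset.sum_coe_sort L.1 (fun w => f.coeff w • word F w)]
      change f = ∑ w ∈ f.coeff.support.erase 1, f.coeff w • word F w
      rw [h]
      conv_lhs => rw [← f.sum_coeff_single]
      refine Finset.sum_congr rfl fun w _ => ?_
      simp [word]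
    refine ⟨K L, ?_⟩
    rw [hfL, sum_smul_word_pow_eq]
    exact sum_mem fun μ _ => Submodule.smul_mem _ _ (relation_mem ρ ⟨L, μ⟩)

end NilIdeal

/-! ### Maximal graded ideals of infinite codimension -/

section PrimeIdeal

variable {F : Type u} [Field F]

theorem IsGradedIdeal.sup {P Q : Submodule F (WordAlgebra F)} (hP : IsGradedIdeal P)
    (hQ : IsGradedIdeal Q) : IsGradedIdeal (P ⊔ Q) where
  mul_left f g hg := by
    obtain ⟨p, hp, q, hq, rfl⟩ := Submodule.mem_sup.1 hg
    rw [mul_add]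
    exact Submodule.add_mem_sup (hP.mul_left f p hp) (hQ.mul_left f q hq)
  mul_right f g hg := by
    obtain ⟨p, hp, q, hq, rfl⟩ := Submodule.mem_sup.1 hg
    rw [add_mul]
    exact Submodule.add_mem_sup (hP.mul_right f p hp) (hQ.mul_right f q hq)
  homogProj_mem n g hg := by
    obtain ⟨p, hp, q, hq, rfl⟩ := Submodule.mem_sup.1 hg
    rw [map_add]
    exact Submodule.add_mem_sup (hP.homogProj_mem n p hp) (hQ.homogProj_mem n q hq)

/-- A chain of graded ideals has an upper bound that contains no homogeneous component unless a
member of the chain does, because homogeneous components are finitely generated. -/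
theorem exists_maximal_gradedIdeal {I : Submodule F (WordAlgebra F)} (hI : IsGradedIdeal I)
    (hIn : ∀ n, ¬ homog F n ≤ I) :
    ∃ P, I ≤ P ∧ Maximal (fun P => IsGradedIdeal P ∧ ∀ n, ¬ homog F n ≤ P) P := by
  refine zorn_le_nonempty₀ {P | IsGradedIdeal P ∧ ∀ n, ¬ homog F n ≤ P} ?_ I ⟨hI, hIn⟩
  intro c hc hchain Q hQ
  have hdir : DirectedOn (· ≤ ·) c := hchain.directedOn
  have hmem : ∀ f, f ∈ sSup c ↔ ∃ P ∈ c, f ∈ P := fun f =>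
    Submodule.mem_sSup_of_directed ⟨Q, hQ⟩ hdir
  refine ⟨sSup c, ⟨⟨?_, ?_, ?_⟩, ?_⟩, fun P hP => le_sSup hP⟩
  · intro f g hg
    obtain ⟨P, hP, hgP⟩ := (hmem g).1 hg
    exact (hmem _).2 ⟨P, hP, (hc hP).1.mul_left f g hgP⟩
  · intro f g hg
    obtain ⟨P, hP, hgP⟩ := (hmem g).1 hg
    exact (hmem _).2 ⟨P, hP, (hc hP).1.mul_right f g hgP⟩
  · intro n g hg
    obtain ⟨P, hP, hgP⟩ := (hmem g).1 hg
    exact (hmem _).2 ⟨P, hP, (hc hP).1.homogProj_mem n g hgP⟩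
  · intro n hn
    have hcomp := (Submodule.fg_iff_compact _).1 (homog_fg (F := F) n)
    rw [CompleteLattice.isCompactElement_iff_le_of_directed_sSup_le] at hcomp
    obtain ⟨P, hP, hnP⟩ := hcomp c ⟨Q, hQ⟩ hdir hn
    exact (hc hP).2 n hnP

/-- Maximal graded ideals among those of infinite codimension are prime in a strong form: if `f`
and `h` are homogeneous and not in `P`, then `f A_m h` is not contained in `P` for arbitrarily
large `m`. -/
theorem exists_mul_mul_notMem {P : Submodule F (WordAlgebra F)}
    (hP : Maximal (fun P => IsGradedIdeal P ∧ ∀ n, ¬ homog F n ≤ P) P) {a b : ℕ}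
    {f h : WordAlgebra F} (hf : f ∈ homog F a) (hh : h ∈ homog F b) (hfP : f ∉ P) (hhP : h ∉ P)
    (m₀ : ℕ) : ∃ m ≥ m₀, ∃ g ∈ homog F m, f * g * h ∉ P := by
  by_contra! hcon
  have hPi := hP.prop.1
  have hbig : ∀ (d : ℕ) (q : WordAlgebra F), q ∈ homog F d → q ∉ P →
      ∃ n, homog F n ≤ P ⊔ relationIdeal fun _ : Unit => q := by
    intro d q hq hqP
    by_contra! hcon
    refine hqP (hP.le_of_ge ⟨hPi.sup (isGradedIdeal_relationIdeal (δ := fun _ => d) fun _ => hq),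
      hcon⟩ le_sup_left (Submodule.mem_sup_right (relation_mem (fun _ : Unit => q) ())))
  obtain ⟨d₁, hd₁⟩ := hbig a f hf hfP
  obtain ⟨d₂, hd₂⟩ := hbig b h hh hhP
  have hmid : ∀ g ∈ homog F m₀, ∀ p ∈ relationIdeal fun _ : Unit => f,
      ∀ q ∈ relationIdeal fun _ : Unit => h, p * g * q ∈ P := by
    intro g hg p hp q hq
    induction hp using Submodule.span_induction with
    | mem _ hp =>
      obtain ⟨u, i, v, rfl⟩ := hp
      induction hq using Submodule.span_induction with
      | mem _ hq =>
        obtain ⟨u', i', v', rfl⟩ := hq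
        have h1 := hcon (v.length + m₀ + u'.length) (by omega) (word F v * g * word F u')
          (mul_mem_homog (mul_mem_homog (word_mem_homog v) hg) (word_mem_homog u'))
        have h2 := hPi.mul_left (word F u) _ (hPi.mul_right (word F v') _ h1)
        convert h2 using 1
        noncomm_ring
      | zero => rw [mul_zero]; exact zero_mem _
      | add f g _ _ hf hg => rw [mul_add]; exact add_mem hf hg
      | smul c f _ hf => rw [mul_smul_comm]; exact Submodule.smul_mem _ _ hf
    | zero => rw [zero_mul, zero_mul]; exact zero_mem _
    | add f g _ _ hf hg => rw [add_mul, add_mul]; exact add_mem hf hg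
    | smul c f _ hf => rw [smul_mul_assoc, smul_mul_assoc]; exact Submodule.smul_mem _ _ hf
  refine hP.prop.2 (d₁ + m₀ + d₂) ?_
  rw [← homog_mul_homog, ← homog_mul_homog, Submodule.mul_le]
  intro r hr s hs
  induction hr using Submodule.mul_induction_on' with
  | mem_mul_mem r hr g hg =>
    obtain ⟨p, hp, p', hp', rfl⟩ := Submodule.mem_sup.1 (hd₁ hr)
    obtain ⟨q, hq, q', hq', rfl⟩ := Submodule.mem_sup.1 (hd₂ hs)
    rw [mul_add, add_mul p, add_mul (p * g) _ q']
    exact add_mem (hPi.mul_left _ _ hq) (add_mem (hPi.mul_right _ _ (hPi.mul_right _ _ hp))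
      (hmid g hg p' hp' q' hq'))
  | add f _ g _ hf hg => rw [add_mul]; exact add_mem hf hg

end PrimeIdeal

/-! ### A graded left ideal with nil quotient -/

section LeftIdeal

variable {F : Type u} [Field F]

theorem homogProj_mul_homog {b : ℕ} (n : ℕ) (f : WordAlgebra F) {g : WordAlgebra F}
    (hg : g ∈ homog F b) : homogProj F (n + b) (f * g) = homogProj F n f * g := by
  induction f using word_induction with
  | hw w =>
    rw [homogProj_of_mem_homog _ (mul_mem_homog (word_mem_homog w) hg), homogProj_word]
    by_cases h : w.length = n
    · rw [if_pos (by omega), if_pos h]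
    · rw [if_neg (by omega), if_neg h, zero_mul]
  | h0 => simp
  | hadd f g hf hg => rw [add_mul, map_add, map_add, hf, hg, add_mul]
  | hsmul c f hf => rw [smul_mul_assoc, map_smul, map_smul, hf, smul_mul_assoc]

theorem homogProj_zero_mul (f : WordAlgebra F) {g : WordAlgebra F} (hg : homogProj F 0 g = 0) :
    homogProj F 0 (f * g) = 0 := by
  obtain ⟨N, hN⟩ := exists_sum_homogProj g
  rw [hN N le_rfl, Finset.mul_sum, map_sum]
  refine Finset.sum_eq_zero fun d _ => ?_
  obtain rfl | ⟨k, rfl⟩ : d = 0 ∨ ∃ k, d = k + 1 := by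
    rcases d with _ | k
    · exact Or.inl rfl
    · exact Or.inr ⟨k, rfl⟩
  · rw [hg, mul_zero, map_zero]
  · obtain ⟨M, hM⟩ := exists_sum_homogProj f
    rw [hM M le_rfl, Finset.sum_mul, map_sum]
    refine Finset.sum_eq_zero fun e _ => ?_
    rw [homogProj_of_mem_homog 0
      (mul_mem_homog (homogProj_mem_homog e f) (homogProj_mem_homog (k + 1) g)),
      if_neg (by omega)]

/-- If `P` contained a letter, a power of the other letter, and hence all words of some length,
would lie in `P`. -/
theorem letter_notMem {P : Submodule F (WordAlgebra F)} (hPi : IsGradedIdeal P)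
    (hPn : ∀ n, ¬ homog F n ≤ P) (hnil : ∀ f, homogProj F 0 f = 0 → ∃ k, f ^ k ∈ P) :
    word F (FreeMonoid.of true) ∉ P := by
  intro hY
  obtain ⟨k, hk⟩ := hnil (word F (FreeMonoid.of false)) (by
    rw [homogProj_word, if_neg (by rw [FreeMonoid.length_of]; omega)])
  have h : ∀ w, word F w ∈ P ∨ word F w = word F (FreeMonoid.of false) ^ w.length := by
    intro w
    induction w using FreeMonoid.inductionOn' with
    | one => exact Or.inr (by simp)
    | of_mul z w ih =>
      rw [map_mul]
      rcases ih with ih | ih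
      · exact Or.inl (hPi.mul_left _ _ ih)
      · cases z
        · refine Or.inr ?_
          rw [ih, FreeMonoid.length_mul, FreeMonoid.length_of, pow_add, pow_one]
        · exact Or.inl (hPi.mul_right _ _ hY)
  refine hPn k (Submodule.span_le.2 ?_)
  rintro _ ⟨w, hw, rfl⟩
  rcases h w with h | h
  · exact h
  · have hw' : w.length = k := hw
    rw [SetLike.mem_coe, h, hw']
    exact hk

/-- The left ideal of all `f` with `f w ∈ P`. -/
def IsGradedIdeal.colon {P : Submodule F (WordAlgebra F)} (hPi : IsGradedIdeal P)
    (w : WordAlgebra F) : Submodule (WordAlgebra F) (WordAlgebra F) where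
  carrier := {f | f * w ∈ P}
  add_mem' {a b} ha hb := by
    have h := add_mem (S := Submodule F (WordAlgebra F)) ha hb
    rwa [← add_mul] at h
  zero_mem' := by
    change 0 * w ∈ P
    rw [zero_mul]
    exact zero_mem _
  smul_mem' c f hf := by
    change c * f * w ∈ P
    rw [mul_assoc]
    exact hPi.mul_left _ _ hf

/-- A proper graded left ideal `J` of the free algebra with a nil quotient module, which contains
the letter `y`, and such that for each homogeneous `u ∉ J` the spaces `A_m u` are not contained in
`y A + J` for arbitrarily large `m`. It is found as `{f | f y ^ k ∈ P}` where `P` is a maximal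
graded ideal of infinite codimension with nil quotient and `y ^ k` is the last power of `y` that is
not in `P`. -/
theorem exists_nil_leftIdeal : ∃ J : Submodule (WordAlgebra F) (WordAlgebra F),
    (∀ n, ∀ f ∈ J, homogProj F n f ∈ J) ∧ word F (FreeMonoid.of true) ∈ J ∧ 1 ∉ J ∧
    (∀ f, homogProj F 0 f = 0 → ∃ k, ∀ g, f ^ k * g ∈ J) ∧
    ∀ d, ∀ u ∈ homog F d, u ∉ J → ∀ m₀, ∃ m ≥ m₀, ∃ g ∈ homog F m,
      ∀ t, g * u - word F (FreeMonoid.of true) * t ∉ J := by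
  obtain ⟨I, hI, hIn, hInil⟩ := exists_nil_gradedIdeal (F := F)
  obtain ⟨P, hIP, hP⟩ := exists_maximal_gradedIdeal hI hIn
  have hPi := hP.prop.1
  have hnil : ∀ f, homogProj F 0 f = 0 → ∃ k, f ^ k ∈ P := fun f hf =>
    (hInil f hf).imp fun k hk => hIP hk
  set Y := word F (FreeMonoid.of true) with hYdef
  have hYd : Y ∈ homog F 1 := by
    have h := word_mem_homog (F := F) (FreeMonoid.of true)
    rwa [FreeMonoid.length_of] at h
  have hY0 : homogProj F 0 Y = 0 := by rw [homogProj_of_mem_homog 0 hYd, if_neg one_ne_zero]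
  have h1 : (1 : WordAlgebra F) ∉ P := by
    intro h1
    refine hP.prop.2 0 fun f _ => ?_
    rw [← mul_one f]
    exact hPi.mul_left f 1 h1
  obtain ⟨k, hkP, hkP'⟩ : ∃ k, Y ^ k ∉ P ∧ Y ^ (k + 1) ∈ P := by
    by_contra! hcon
    obtain ⟨l, hl⟩ := hnil Y hY0
    have h2 : ∀ k, Y ^ k ∉ P := by
      intro k
      induction k with
      | zero => rwa [pow_zero]
      | succ k ih => exact hcon k ih
    exact h2 l hl
  have hk0 : k ≠ 0 := by
    rintro rfl
    rw [zero_add, pow_one] at hkP'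
    exact letter_notMem hPi hP.prop.2 hnil hkP'
  have hkd : Y ^ k ∈ homog F k := by
    clear hkP hkP' hk0
    induction k with
    | zero => rw [pow_zero]; exact one_mem_homog
    | succ k ih => rw [pow_succ]; exact mul_mem_homog ih hYd
  refine ⟨hPi.colon (Y ^ k), ?_, ?_, ?_, ?_, ?_⟩
  · intro n f hf
    change homogProj F n f * Y ^ k ∈ P
    rw [← homogProj_mul_homog n f hkd]
    exact hPi.homogProj_mem _ _ hf
  · change Y * Y ^ k ∈ P
    rwa [← pow_succ']
  · intro h
    have h' : 1 * Y ^ k ∈ P := h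
    rw [one_mul] at h'
    exact hkP h'
  · intro f hf
    obtain ⟨l, hl⟩ := hnil f hf
    exact ⟨l, fun g => hPi.mul_right _ _ (hPi.mul_right _ _ hl)⟩
  · intro d u hu huJ m₀
    have huP : u * Y ^ k ∉ P := huJ
    obtain ⟨m, hm, g, hg, hgP⟩ := exists_mul_mul_notMem hP hkd (mul_mem_homog hu hkd) hkP huP m₀
    refine ⟨m, hm, g, hg, fun t ht => hgP ?_⟩
    have ht' : (g * u - Y * t) * Y ^ k ∈ P := ht
    have h2 := add_mem (hPi.mul_left (Y ^ k) _ ht') (hPi.mul_right (t * Y ^ k) _ hkP')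
    convert h2 using 1
    rw [pow_succ]
    noncomm_ring

end LeftIdeal

/-! ### Bases of words -/

section WordBasis

variable {F : Type u} [Field F] {U : Type*} [AddCommGroup U] [Module F U]
  [Module (WordAlgebra F) U] [IsScalarTower F (WordAlgebra F) U]

/-- The coordinates with respect to a basis of images of words in a graded cyclic module are
homogeneous. -/
theorem Module.Basis.coord_smul_eq_zero {κ : Type*} (b : Module.Basis κ F U) {e : U}
    (hgr : ∀ n (f : WordAlgebra F), f • e = 0 → homogProj F n f • e = 0) {w : κ → FreeMonoid Bool}
    (hw : ∀ i, b i = word F (w i) • e) (i : κ) {d : ℕ} {f : WordAlgebra F} (hf : f ∈ homog F d)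
    (hd : (w i).length ≠ d) : b.coord i (f • e) = 0 := by
  classical
  -- Write `f e` as a combination of basis vectors and project to degree `d`.
  have h1 : f • e = (∑ j ∈ (b.repr (f • e)).support,
      b.repr (f • e) j • word F (w j)) • e := by
    conv_lhs => rw [← b.linearCombination_repr (f • e), Finsupp.linearCombination_apply]
    rw [Finsupp.sum, Finset.sum_smul]
    exact Finset.sum_congr rfl fun j _ => by rw [hw, smul_assoc]
  have h2 := hgr d (f - ∑ j ∈ (b.repr (f • e)).support, b.repr (f • e) j • word F (w j))
    (by rw [sub_smul, ← h1, sub_self])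
  rw [map_sub, homogProj_eq_self hf, sub_smul, sub_eq_zero, map_sum, Finset.sum_smul] at h2
  rw [h2, map_sum]
  refine Finset.sum_eq_zero fun j _ => ?_
  rw [(homogProj F d).map_smul, homogProj_word]
  split_ifs with h
  · have hji : j ≠ i := by
      rintro rfl
      exact hd h
    rw [smul_assoc, ← hw, map_smul, Module.Basis.coord_apply, Module.Basis.repr_self,
      Finsupp.single_eq_of_ne hji.symm, smul_zero]
  · rw [smul_zero, zero_smul, map_zero]

/-- A graded cyclic module in which the nonzero homogeneous elements have multiples of arbitrarily
large degree outside the image of `y` has a basis of images of words that is indexed by `ℕ`, and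
part of which is a basis of the image of `y`. -/
theorem exists_wordBasis {e : U} (hcyc : ∀ u : U, ∃ f : WordAlgebra F, f • e = u)
    (hgr : ∀ n (f : WordAlgebra F), f • e = 0 → homogProj F n f • e = 0) (he : e ≠ 0)
    (hbig : ∀ d, ∀ u ∈ homog F d, u • e ≠ 0 → ∀ m₀, ∃ m ≥ m₀, ∃ g ∈ homog F m,
      ∀ t : U, g • u • e ≠ word F (FreeMonoid.of true) • t) :
    ∃ (b : Module.Basis ℕ F U) (o : ℕ) (w : ℕ → FreeMonoid Bool) (S : Set ℕ),
      (∀ i, b i = word F (w i) • e) ∧ w o = 1 ∧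
      (∀ i, i ∉ S → ∀ u, b.coord i (word F (FreeMonoid.of true) • u) = 0) ∧
      ∀ u, (∀ i, i ∉ S → b.coord i u = 0) → ∃ t, word F (FreeMonoid.of true) • t = u := by
  classical
  obtain ⟨s, hs, hspan, hind⟩ := exists_linearIndependent F
    (Set.range fun w => word F (FreeMonoid.of true * w) • e)
  have hst : s ⊆ Set.range fun w => word F w • e := by
    refine hs.trans ?_
    rintro _ ⟨w, rfl⟩
    exact ⟨_, rfl⟩
  have hs' : LinearIndepOn F id s := hind
  have hwspan : ∀ f : WordAlgebra F,
      f • e ∈ Submodule.span F (Set.range fun w => word F w • e) := by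
    intro f
    induction f using word_induction with
    | hw w => exact Submodule.subset_span ⟨w, rfl⟩
    | h0 => rw [zero_smul]; exact zero_mem _
    | hadd f g hf hg => rw [add_smul]; exact add_mem hf hg
    | hsmul c f hf => rw [smul_assoc]; exact Submodule.smul_mem _ _ hf
  have hyspan : ∀ f : WordAlgebra F,
      word F (FreeMonoid.of true) • f • e ∈ Submodule.span F s := by
    intro f
    rw [hspan]
    induction f using word_induction with
    | hw w => exact Submodule.subset_span ⟨w, by simp only [map_mul, mul_smul]⟩
    | h0 => rw [zero_smul, smul_zero]; exact zero_mem _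
    | hadd f g hf hg => rw [add_smul, smul_add]; exact add_mem hf hg
    | hsmul c f hf =>
      rw [← mul_smul, mul_smul_comm, smul_assoc, mul_smul]
      exact Submodule.smul_mem _ _ hf
  let κ : Set U := hs'.extend hst
  have hsκ : s ⊆ κ := hs'.subset_extend hst
  have hκt : κ ⊆ Set.range fun w => word F w • e := hs'.extend_subset hst
  have hκspan : Submodule.span F κ = ⊤ := by
    rw [hs'.span_extend_eq_span hst, eq_top_iff]
    intro u _
    obtain ⟨f, rfl⟩ := hcyc u
    exact hwspan f
  have hκind : LinearIndependent F (Subtype.val : κ → U) := hs'.linearIndepOn_extend hst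
  let b : Module.Basis κ F U := Module.Basis.mk hκind (by rw [Subtype.range_coe, hκspan])
  have hb : ∀ i, b i = i.1 := fun i => Module.Basis.mk_apply hκind _ i
  choose w hw using fun i : κ => hκt i.2
  replace hw : ∀ i, b i = word F (w i) • e := fun i => (hb i).trans (hw i).symm
  have hcoord : ∀ i {d : ℕ} {f : WordAlgebra F}, f ∈ homog F d → (w i).length ≠ d →
      b.coord i (f • e) = 0 := fun i _ _ hf hd => b.coord_smul_eq_zero hgr hw i hf hd
  -- A nonzero element has a nonzero coordinate.
  have hne : ∀ u : U, u ≠ 0 → ∃ i, b.coord i u ≠ 0 := by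
    intro u hu
    by_contra! hcon
    exact hu (b.ext_elem fun i => by simpa using hcon i)
  obtain ⟨o, ho⟩ : ∃ o, w o = 1 := by
    obtain ⟨o, ho⟩ := hne e he
    refine ⟨o, FreeMonoid.length_eq_zero.1 ?_⟩
    by_contra hd
    have h := hcoord o one_mem_homog hd
    rw [one_smul] at h
    exact ho h
  have hcount : Countable κ := by
    have : Countable (FreeMonoid Bool) := inferInstanceAs (Countable (List Bool))
    exact ((Set.countable_range _).mono hκt).to_subtype
  have hinf : Infinite κ := by
    by_contra hfin
    rw [not_infinite_iff_finite] at hfin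
    obtain ⟨D, hD⟩ := (Set.finite_range fun i => (w i).length).bddAbove
    obtain ⟨m, hm, g, hg, hgt⟩ := hbig 0 1 one_mem_homog (by rwa [one_smul]) (D + 1)
    rw [one_smul] at hgt
    obtain ⟨i, hi⟩ := hne (g • e) (by
      have := hgt 0
      rwa [smul_zero] at this)
    refine hi (hcoord i hg ?_)
    have := hD ⟨i, rfl⟩
    simp only at this
    omega
  obtain ⟨ε⟩ : Nonempty (κ ≃ ℕ) := nonempty_equiv_of_countable
  refine ⟨b.reindex ε, ε o, fun n => w (ε.symm n), {n | (ε.symm n : U) ∈ s}, ?_, ?_, ?_, ?_⟩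
  · intro i
    rw [Module.Basis.reindex_apply, hw]
  · simp only [ε.symm_apply_apply, ho]
  · intro i hi u
    obtain ⟨f, rfl⟩ := hcyc u
    have hker : Submodule.span F s ≤ LinearMap.ker ((b.reindex ε).coord i) := by
      refine Submodule.span_le.2 fun v hv => ?_
      have hvb : v = b ⟨v, hsκ hv⟩ := (hb ⟨v, hsκ hv⟩).symm
      rw [SetLike.mem_coe, LinearMap.mem_ker, Module.Basis.coord_apply,
        Module.Basis.repr_reindex_apply, hvb, Module.Basis.repr_self]
      refine Finsupp.single_eq_of_ne ?_
      intro h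
      refine hi ?_
      rw [Set.mem_ofPred_eq, h]
      exact hv
    exact hker (hyspan f)
  · intro u hu
    have hmem : u ∈ Submodule.span F s := by
      rw [← b.linearCombination_repr u, Finsupp.linearCombination_apply]
      refine sum_mem fun i _ => ?_
      by_cases hi : (i : U) ∈ s
      · refine Submodule.smul_mem _ _ (Submodule.subset_span ?_)
        rw [hb]
        exact hi
      · have h := hu (ε i) (by rw [Set.mem_ofPred_eq, ε.symm_apply_apply]; exact hi)
        rw [Module.Basis.coord_apply, Module.Basis.repr_reindex_apply, ε.symm_apply_apply] at h
        simp only [h, zero_smul]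
        exact zero_mem _
    rw [hspan] at hmem
    clear hu
    induction hmem using Submodule.span_induction with
    | mem _ h =>
      obtain ⟨w, rfl⟩ := h
      exact ⟨word F w • e, by simp only [map_mul, mul_smul]⟩
    | zero => exact ⟨0, smul_zero _⟩
    | add _ _ _ _ h h' =>
      obtain ⟨t, rfl⟩ := h
      obtain ⟨t', rfl⟩ := h'
      exact ⟨t + t', smul_add _ _ _⟩
    | smul c _ _ h =>
      obtain ⟨t, rfl⟩ := h
      refine ⟨c • t, ?_⟩
      rw [← algebraMap_smul (WordAlgebra F) c t,
        ← algebraMap_smul (WordAlgebra F) c (word F (FreeMonoid.of true) • t), ← mul_smul,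
        ← mul_smul, Algebra.commutes]

end WordBasis

/-! ### Existence of the nil module -/

section NilModule

variable {F : Type u} [Field F]

/-- If an infinite family of functionals separates the points of a finite-dimensional space `U`,
then every functional on the space agrees on `U` with a linear combination of the family. -/
theorem exists_mem_span_eq_on {V : Type*} [AddCommGroup V] [Module F V] (U : Submodule F V)
    [FiniteDimensional F U] (T : Set (V →ₗ[F] F))
    (hT : ∀ u ∈ U, (∀ t ∈ T, t u = 0) → u = 0) (f : V →ₗ[F] F) :
    ∃ t ∈ Submodule.span F T, ∀ u ∈ U, t u = f u := by
  let R : (V →ₗ[F] F) →ₗ[F] Module.Dual F U := LinearMap.lcomp F F U.subtype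
  let W : Subspace F (Module.Dual F U) := (Submodule.span F T).map R
  have hW : W.dualCoannihilator = ⊥ := by
    rw [eq_bot_iff]
    intro u hu
    rw [Submodule.mem_dualCoannihilator] at hu
    rw [Submodule.mem_bot]
    refine Subtype.ext (hT u u.2 fun t ht => ?_)
    exact hu (R t) ⟨t, Submodule.subset_span ht, rfl⟩
  have hW' : W = ⊤ := by
    rw [← Subspace.dualCoannihilator_dualAnnihilator_eq (W := W), hW,
      Submodule.dualAnnihilator_bot]
  obtain ⟨t, ht, htf⟩ : R f ∈ W := hW' ▸ Submodule.mem_top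
  exact ⟨t, ht, fun u hu => LinearMap.congr_fun htf ⟨u, hu⟩⟩

variable {φ : WordAlgebra F →ₐ[F] Module.End F (ℕ →₀ F)}

theorem exists_of_mem_adjoin_letters {n : Module.End F (ℕ →₀ F)}
    (hn : n ∈ NonUnitalAlgebra.adjoin F
      {φ (word F (FreeMonoid.of false)), φ (word F (FreeMonoid.of true))}) :
    ∃ f, homogProj F 0 f = 0 ∧ φ f = n := by
  have hletter : ∀ z, homogProj F 0 (word F (FreeMonoid.of z)) = 0 := fun z => by
    rw [homogProj_word, if_neg (by rw [FreeMonoid.length_of]; exact one_ne_zero)]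
  induction hn using NonUnitalAlgebra.adjoin_induction with
  | mem _ h =>
    rcases h with rfl | rfl
    · exact ⟨_, hletter _, rfl⟩
    · exact ⟨_, hletter _, rfl⟩
  | zero => exact ⟨0, map_zero _, map_zero _⟩
  | add _ _ _ _ h h' =>
    obtain ⟨f, hf, rfl⟩ := h
    obtain ⟨g, hg, rfl⟩ := h'
    exact ⟨f + g, by rw [map_add, hf, hg, add_zero], map_add _ _ _⟩
  | mul _ _ _ _ h h' =>
    obtain ⟨f, hf, rfl⟩ := h
    obtain ⟨g, hg, rfl⟩ := h'
    exact ⟨f * g, homogProj_zero_mul f hg, map_mul _ _ _⟩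
  | smul c _ _ h =>
    obtain ⟨f, hf, rfl⟩ := h
    exact ⟨c • f, by rw [map_smul, hf, smul_zero], map_smul _ _ _⟩

theorem map_word_mem_adjoin_letters (w : FreeMonoid Bool) (hw : w ≠ 1) :
    φ (word F w) ∈ NonUnitalAlgebra.adjoin F
      {φ (word F (FreeMonoid.of false)), φ (word F (FreeMonoid.of true))} := by
  have hletter : ∀ z, φ (word F (FreeMonoid.of z)) ∈ NonUnitalAlgebra.adjoin F
      {φ (word F (FreeMonoid.of false)), φ (word F (FreeMonoid.of true))} := by
    intro z
    cases z
    · exact NonUnitalAlgebra.subset_adjoin F (Or.inl rfl)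
    · exact NonUnitalAlgebra.subset_adjoin F (Or.inr rfl)
  induction w using FreeMonoid.inductionOn' with
  | one => exact absurd rfl hw
  | of_mul z w ih =>
    by_cases h : w = 1
    · rw [h, mul_one]
      exact hletter z
    · rw [map_mul, map_mul]
      exact mul_mem (hletter z) (ih h)

/-- A representation of the free algebra on `F^(ℕ)` in which `e_o` is cyclic, the basis vectors are
homogeneous, and the image of `y` is spanned by basis vectors and contains no homogeneous component
`A_m u`, `m` large, for nonzero homogeneous `u`. -/
theorem isNilModule_of_representation (o : ℕ) (w : ℕ → FreeMonoid Bool) (S : Set ℕ)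
    (hnil : ∀ f, homogProj F 0 f = 0 → IsNilpotent (φ f))
    (hy : φ (word F (FreeMonoid.of true)) (Finsupp.single o 1) = 0)
    (hw : ∀ i, Finsupp.single i 1 = φ (word F (w i)) (Finsupp.single o 1)) (ho : w o = 1)
    (hdeg : ∀ i d, ∀ f ∈ homog F d, (w i).length ≠ d → φ f (Finsupp.single o 1) i = 0)
    (hS : ∀ i, i ∉ S → ∀ u, φ (word F (FreeMonoid.of true)) u i = 0)
    (hrange : ∀ u : ℕ →₀ F, (∀ i, i ∉ S → u i = 0) →
      ∃ t, φ (word F (FreeMonoid.of true)) t = u)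
    (hbig : ∀ d, ∀ f ∈ homog F d, φ f (Finsupp.single o 1) ≠ 0 → ∀ m₀, ∃ m ≥ m₀,
      ∃ g ∈ homog F m, ∀ t,
        φ g (φ f (Finsupp.single o 1)) ≠ φ (word F (FreeMonoid.of true)) t) :
    IsNilModule (φ (word F (FreeMonoid.of false))) (φ (word F (FreeMonoid.of true))) o := by
  have hletter : ∀ z u, φ (word F (FreeMonoid.of z)) u o = 0 := by
    intro z u
    have hlin : (Finsupp.lapply o : (ℕ →₀ F) →ₗ[F] F) ∘ₗ φ (word F (FreeMonoid.of z)) = 0 := by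
      refine Finsupp.lhom_ext' fun i => LinearMap.ext_ring ?_
      simp only [LinearMap.comp_apply, Finsupp.lsingle_apply, Finsupp.lapply_apply,
        LinearMap.zero_apply]
      rw [hw i, ← Module.End.mul_apply, ← map_mul, ← map_mul]
      refine hdeg o _ _ (word_mem_homog _) ?_
      rw [ho, FreeMonoid.length_one, FreeMonoid.length_mul, FreeMonoid.length_of]
      omega
    exact LinearMap.congr_fun hlin u
  refine ⟨fun n hn => ?_, hy, hletter false, hletter true, fun W hoW hW => ?_, fun j m => ?_⟩
  · obtain ⟨f, hf, rfl⟩ := exists_of_mem_adjoin_letters hn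
    exact hnil f hf
  · have hword : ∀ v, φ (word F v) (Finsupp.single o 1) ∈ W := by
      intro v
      induction v using FreeMonoid.inductionOn' with
      | one => rwa [map_one, map_one, Module.End.one_apply]
      | of_mul z v ih =>
        rw [map_mul, map_mul, Module.End.mul_apply]
        cases z
        · exact (hW _ ih).1
        · exact (hW _ ih).2
    rw [eq_top_iff, ← Finsupp.span_single_eq_top, Submodule.span_le]
    rintro _ ⟨i, c, rfl⟩
    rw [← mul_one c, ← smul_eq_mul, ← Finsupp.smul_single, hw i]
    exact W.smul_mem c (hword _)
  · -- The degree `d` of `e_j`, and a bound `D` for the degrees of the `e_i` with `i < m`.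
    obtain ⟨d, hd⟩ : ∃ d, (w j).length = d := ⟨_, rfl⟩
    let D := (Finset.range m).sup fun i => (w i).length
    let E : WordAlgebra F →ₗ[F] (ℕ →₀ F) :=
      (LinearMap.applyₗ (Finsupp.single o (1 : F))).comp φ.toLinearMap
    have hE : ∀ f, E f = φ f (Finsupp.single o 1) := fun f => rfl
    let U : Submodule F (ℕ →₀ F) := (homog F d).map E
    let T : Set ((ℕ →₀ F) →ₗ[F] F) := {f | ∃ i, ∃ v : FreeMonoid Bool, D < v.length ∧
      (w i).length = v.length + d ∧ i ∉ S ∧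
      f = (Finsupp.lapply i : (ℕ →₀ F) →ₗ[F] F) ∘ₗ φ (word F v)}
    obtain ⟨t, ht, htj⟩ := exists_mem_span_eq_on U T (fun u hu h => by
      obtain ⟨f, hf, rfl⟩ := hu
      by_contra hne
      obtain ⟨M, hM, g, hg, hgt⟩ := hbig d f hf hne (D + 1)
      -- Some word `v` of length `M` does not map `u` into the image of `y`.
      have hex : ∃ v : FreeMonoid Bool, v.length = M ∧ ∃ i, i ∉ S ∧ φ (word F v) (E f) i ≠ 0 := by
        by_contra! hcon
        obtain ⟨t, ht⟩ := hrange (φ g (E f)) fun i hi => by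
          clear hgt
          induction hg using Submodule.span_induction with
          | mem _ h => obtain ⟨v, hv, rfl⟩ := h; exact hcon v hv i hi
          | zero => rw [map_zero]; rfl
          | add _ _ _ _ h h' =>
            rw [map_add, LinearMap.add_apply, Finsupp.add_apply, h, h', add_zero]
          | smul c _ _ h => rw [map_smul, LinearMap.smul_apply, Finsupp.smul_apply, h, smul_zero]
        exact hgt t ht.symm
      obtain ⟨v, hv, i, hi, hvi⟩ := hex
      have hwi : (w i).length = v.length + d := by
        by_contra hne
        refine hvi ?_
        rw [hE, ← Module.End.mul_apply, ← map_mul]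
        exact hdeg i _ _ (mul_mem_homog (word_mem_homog v) hf) hne
      exact hvi (h _ ⟨i, v, by omega, hwi, hi, rfl⟩)) (Finsupp.lapply j)
    have heq : Finsupp.lapply j = t := by
      refine Finsupp.lhom_ext' fun i => LinearMap.ext_ring ?_
      simp only [LinearMap.comp_apply, Finsupp.lsingle_apply]
      by_cases hi : (w i).length = d
      · refine (htj _ ?_).symm
        rw [hw i]
        exact ⟨_, hi ▸ word_mem_homog _, rfl⟩
      · have h1 : t (Finsupp.single i 1) = 0 := by
          clear htj
          induction ht using Submodule.span_induction with
          | mem _ h =>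
            obtain ⟨l, v, -, hl, -, rfl⟩ := h
            rw [hw i, LinearMap.comp_apply, ← Module.End.mul_apply, ← map_mul, ← map_mul]
            refine hdeg l _ _ (word_mem_homog _) ?_
            rw [hl, FreeMonoid.length_mul]
            omega
          | zero => rfl
          | add _ _ _ _ h h' => rw [LinearMap.add_apply, h, h', add_zero]
          | smul c _ _ h => rw [LinearMap.smul_apply, h, smul_zero]
        rw [h1, Finsupp.lapply_apply, Finsupp.single_eq_of_ne]
        rintro rfl
        exact hi hd
    rw [heq]
    refine Submodule.span_mono ?_ ht
    rintro _ ⟨i, v, hv, hi, hiS, rfl⟩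
    refine ⟨i, ?_, hS i hiS, _, map_word_mem_adjoin_letters v ?_, rfl⟩
    · by_contra him
      have := Finset.le_sup (f := fun i => (w i).length) (Finset.mem_range.2 (not_le.1 him))
      change (w i).length ≤ D at this
      omega
    · rintro rfl
      rw [FreeMonoid.length_one] at hv
      omega

variable (F) in
theorem exists_isNilModule : ∃ (x y : Module.End F (ℕ →₀ F)) (o : ℕ), IsNilModule x y o := by
  obtain ⟨J, hcomp, hyJ, h1J, hnil, hbig⟩ := exists_nil_leftIdeal (F := F)
  let U := WordAlgebra F ⧸ J
  let e : U := Submodule.Quotient.mk 1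
  have he : ∀ f : WordAlgebra F, f • e = Submodule.Quotient.mk f := fun f => by
    rw [← Submodule.Quotient.mk_smul, smul_eq_mul, mul_one]
  have he0 : ∀ f : WordAlgebra F, f • e = 0 ↔ f ∈ J := fun f => by
    rw [he, Submodule.Quotient.mk_eq_zero]
  have hcyc : ∀ u : U, ∃ f : WordAlgebra F, f • e = u := fun u => by
    obtain ⟨f, rfl⟩ := Submodule.Quotient.mk_surjective J u
    exact ⟨f, he f⟩
  have hbig' : ∀ d, ∀ u ∈ homog F d, u • e ≠ 0 → ∀ m₀, ∃ m ≥ m₀, ∃ g ∈ homog F m,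
      ∀ t : U, g • u • e ≠ word F (FreeMonoid.of true) • t := by
    intro d u hu hue m₀
    obtain ⟨m, hm, g, hg, hgt⟩ := hbig d u hu (fun h => hue ((he0 u).2 h)) m₀
    refine ⟨m, hm, g, hg, fun t ht => ?_⟩
    obtain ⟨f, rfl⟩ := hcyc t
    refine hgt f ((he0 _).1 ?_)
    rw [sub_smul, mul_smul, mul_smul, ht, sub_self]
  obtain ⟨b, o, w, S, hbw, hwo, hS, hrange⟩ := exists_wordBasis hcyc
    (fun n f hf => (he0 _).2 (hcomp n f ((he0 f).1 hf)))
    (fun h => h1J ((he0 1).1 (by rw [one_smul]; exact h))) hbig'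
  have hbo : b o = e := by rw [hbw, hwo, map_one, one_smul]
  let φ : WordAlgebra F →ₐ[F] Module.End F (ℕ →₀ F) :=
    (b.repr.conjAlgEquiv F).toAlgHom.comp (Algebra.lsmul F F U)
  have hφ : ∀ f u, φ f u = b.repr (f • b.repr.symm u) := fun f u => rfl
  have hφo : ∀ f, φ f (Finsupp.single o 1) = b.repr (f • e) := fun f => by
    rw [hφ, b.repr_symm_single, one_smul, hbo]
  refine ⟨_, _, o, isNilModule_of_representation (φ := φ) o w S ?_ ?_ ?_ hwo ?_ ?_ ?_ ?_⟩
  · intro f hf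
    obtain ⟨k, hk⟩ := hnil f hf
    refine ⟨k, LinearMap.ext fun u => ?_⟩
    rw [← map_pow, hφ]
    obtain ⟨g, hg⟩ := hcyc (b.repr.symm u)
    rw [← hg, ← mul_smul, (he0 _).2 (hk g), map_zero]
    rfl
  · rw [hφo, (he0 _).2 hyJ, map_zero]
  · intro i
    rw [hφo, ← hbw, b.repr_self]
  · intro i d f hf hd
    rw [hφo]
    exact b.coord_smul_eq_zero (fun n f hf => (he0 _).2 (hcomp n f ((he0 f).1 hf))) hbw i hf hd
  · intro i hi u
    rw [hφ]
    exact hS i hi _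
  · intro u hu
    obtain ⟨t, ht⟩ := hrange (b.repr.symm u) fun i hi => by
      rw [Module.Basis.coord_apply, LinearEquiv.apply_symm_apply, hu i hi]
    exact ⟨b.repr t, by rw [hφ, LinearEquiv.symm_apply_apply, ht, LinearEquiv.apply_symm_apply]⟩
  · intro d f hf hne m₀
    obtain ⟨m, hm, g, hg, hgt⟩ := hbig' d f hf (fun h => hne (by rw [hφo, h, map_zero])) m₀
    refine ⟨m, hm, g, hg, fun t ht => hgt (b.repr.symm t) ?_⟩
    rw [hφo, hφ, hφ, LinearEquiv.symm_apply_apply] at ht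
    exact b.repr.injective ht

end NilModule

/-! ### The embedding -/

section Embedding

variable (F : Type u) [Field F] (A : Type v) [NonUnitalRing A] [Module F A]

/-- The embedding theorem, given a nil module. -/
theorem exists_algebra_of_isNilModule [IsScalarTower F A A] [SMulCommClass F A A]
    {x y : Module.End F (ℕ →₀ F)} {o : ℕ}
    (hM : IsNilModule x y o) (hdim : Module.rank F A ≤ Cardinal.aleph0)
    (halg : IsStableAlgebraic F A) (hprim : IsPrimitiveAlgebra F A) :
    ∃ (B : Type (max u v)) (_ : NonUnitalRing B) (_ : Module F B) (_ : IsScalarTower F B B)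
      (_ : SMulCommClass F B B),
      IsTwoGenerated F B ∧ IsAlgebraicAlgebra F B ∧ IsPrimitiveAlgebra F B ∧
        IsMInftyEmbeddableAsLeftIdeal F A B := by
  obtain ⟨V, _, _, ρ, hinj, hirr⟩ := hprim
  obtain ⟨a, ha⟩ := exists_span_range_eq_top hdim
  obtain ⟨fn, p, κ, r, hD⟩ := hM.exists_isRowData fun t => ρ (a t)
  have hspan : ∀ b, ρ b ∈ Submodule.span F (Set.range fun t => ρ (a t)) := by
    intro b
    have hb : b ∈ Submodule.span F (Set.range a) := ha ▸ Submodule.mem_top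
    have := Submodule.mem_map_of_mem (f := (ρ : A →ₗ[F] Module.End F V)) hb
    rw [Submodule.map_span, ← Set.range_comp] at this
    exact this
  have hw := row_single_origin o p κ r (F := F)
  have hynil := hM.isNilpotent y (NonUnitalAlgebra.subset_adjoin F (by simp))
  have hc := rowOp_mem_adjoin (W := (ℕ →₀ F) ⊗[F] V) (x := x) hw hM.y_apply
    (row_y_apply hM hD) hynil
  have hy := rTensor_mem_adjoin (W := (ℕ →₀ F) ⊗[F] V) (x := x) hw hM.y_apply
    (row_y_apply hM hD) hynil
  have hx : x.rTensor ((ℕ →₀ F) ⊗[F] V) ∈ NonUnitalAlgebra.adjoin F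
      {x.rTensor ((ℕ →₀ F) ⊗[F] V), y.rTensor ((ℕ →₀ F) ⊗[F] V) +
        rowOp (row o p κ r) (Finsupp.single o (1 : F))} :=
    NonUnitalAlgebra.subset_adjoin F (by simp)
  have hunit := fun i j b => blockUnit_mem hM hD hx hy hc i j (hspan b)
  refine exists_algebra_of_operators F A (x.rTensor ((ℕ →₀ F) ⊗[F] V))
    (y.rTensor ((ℕ →₀ F) ⊗[F] V) + rowOp (row o p κ r) (Finsupp.single o (1 : F)))
    (finitaryRep ρ) (finitaryRep_injective hinj) (fun M => ?_)
    (rTensor_mul_mem_range_finitaryRep ρ x) (fun M => ?_) ?_ ?_ ?_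
  · rw [finitaryRep_apply]
    exact sum_mem fun _ _ => hunit _ _ _
  · rw [add_mul]
    exact add_mem (rTensor_mul_mem_range_finitaryRep ρ y M) (rowOp_mul_mem_range_finitaryRep hD M)
  · exact isAlgebraic_of_mem_adjoin hM.isNilpotent
      (stablyAlgebraic_range halg ρ).scalarExtension.rankIdeal.scalarExtension
      (row_mem_scalarExtension hD fun t => ⟨a t, rfl⟩)
  · obtain ⟨b, z, hz⟩ := exists_blockUnit_apply_ne_zero hirr
    exact ⟨_, hunit 0 0 b, z, hz⟩
  · exact fun N hN => eq_bot_or_eq_top_of_blockUnit hirr N fun i j b z hz => hN _ (hunit i j b) z hz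

end Embedding

theorem theorem5p1 (F : Type u) [Field F] (A : Type v) [NonUnitalRing A] [Module F A]
    [IsScalarTower F A A] [SMulCommClass F A A]
    (hdim : Module.rank F A ≤ Cardinal.aleph0)
    (halg : IsStableAlgebraic F A) (hprim : IsPrimitiveAlgebra F A) :
    ∃ (B : Type (max u v)) (_ : NonUnitalRing B) (_ : Module F B) (_ : IsScalarTower F B B)
      (_ : SMulCommClass F B B),
      IsTwoGenerated F B ∧ IsAlgebraicAlgebra F B ∧ IsPrimitiveAlgebra F B ∧
        IsMInftyEmbeddableAsLeftIdeal F A B := by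
  obtain ⟨x, y, o, hM⟩ := exists_isNilModule F
  exact exists_algebra_of_isNilModule F A hM hdim halg hprim
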